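/- Let $n,d\ge 0$ be integers and $N=n+d$. A formal generic submanifold $M$ of codimension $d$ (CR dimension $n$) through $0\in\mathbb C^N$ is given by $\rho\in\mathbb C[[Z,\zeta]]^d$ with $\rho(Z,\zeta)=\bar\rho(\zeta,Z)$, $\rho(0)=0$ and $\partial_Z\rho_1(0)\wedge\dots\wedge\partial_Z\rho_d(0)\ne0$, where a bar over a series denotes complex conjugation of its coefficients. Normal coordinates for $M$ are a formal invertible change of coordinates $Z=Z(z,w)$, $(z,w)\in\mathbb C^n\times\mathbb C^d$, fixing $0$, such that $\rho(Z(z,w),\bar Z(\chi,\tau))=a(z,w,\chi,\tau)\,(w-Q(z,\chi,\tau))$ with $a$ an invertible $d\times d$ matrix of power series and $Q_j(0,\chi,\tau)=Q_j(z,0,\tau)=\tau_j$. Write $Q^j(z,\chi,0)=\sum_\alpha q^j_\alpha(\chi)z^\alpha$ and let $I_M\subset\mathbb C[[\chi]]$ be the ideal generated by all the $q^j_\alpha$. Then $M$ is essentially finite at $0$ if $\dim_{\mathbb C}\mathbb C[[\chi]]/I_M<\infty$, and this dimension is then denoted $\mathrm{Ess}_0(M)$. Let $M,\widetilde M$ be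 formal generic submanifolds of codimension $d$ through $0\in\mathbb C^N$, with defining series $\rho,\tilde\rho$, and let $H\colon(\mathbb C^N,0)\to(\mathbb C^N,0)$ be a formal holomorphic mapping ($H\in\mathbb C[[Z]]^N$, $H(0)=0$) sending $M$ into $\widetilde M$, i.e. $\tilde\rho(H(Z),\bar H(\zeta))=c(Z,\zeta)\rho(Z,\zeta)$ for some $d\times d$ matrix $c$ of formal power series. Assume that $H$ is CR transversal to $\widetilde M$ at $0$, i.e. $T^{1,0}_0\widetilde M+dH(T^{1,0}_0\mathbb C^N)=T^{1,0}_0\mathbb C^N$, where $T^{1,0}_0\widetilde M=\{v\in\mathbb C^N:\sum_k v_k\,\partial\tilde\rho_j/\partial Z_k(0)=0,\ j=1,\dots,d\}$ under the identification $T^{1,0}_0\mathbb C^N=\mathbb C^N$. Fix any normal coordinates $(z,w)$ for $M$ and $(\tilde z,\tilde w)$ for $\widetilde M$, and write $H=(F,G)$ in these coordinates. Say that $H$ is Segre finite if $\dim_{\mathbb C}\mathbb C[[z]]/I(F(z,0))<\infty$, where $I(F(z,0))$ is the ideal generated by the components of $F(z,0)$, and then denote this dimension by $m_H$. Then, with all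 notions computed in the chosen normal coordinates: (1) if $M$ is essentially finite at $0$, then $\widetilde M$ is essentially finite at $0$, $H$ is Segre finite, and $\mathrm{Ess}_0(M)=m_H\,\mathrm{Ess}_0(\widetilde M)$; (2) if $\widetilde M$ is essentially finite at $0$ and $H$ is Segre finite, then $M$ is essentially finite at $0$ and $\mathrm{Ess}_0(M)=m_H\,\mathrm{Ess}_0(\widetilde M)$. -/

import Mathlib

noncomputable section

/-- The series obtained by replacing each coefficient by its complex conjugate. -/
def conjSeries {σ : Type} (f : MvPowerSeries σ ℂ) : MvPowerSeries σ ℂ :=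
  MvPowerSeries.map (starRingEnd ℂ) f

/-- A formal holomorphic mapping `(ℂ^σ, 0) → (ℂ^τ, 0)`: a tuple of formal power series in the
variables `σ`, indexed by `τ`, without constant terms. -/
@[ext]
structure FormalMap (σ τ : Type) where
  toSeries : τ → MvPowerSeries σ ℂ
  constantCoeff_eq_zero : ∀ k, MvPowerSeries.constantCoeff (toSeries k) = 0

namespace FormalMap

theorem hasSubst {σ τ : Type} [Finite τ] (f : FormalMap σ τ) :
    MvPowerSeries.HasSubst f.toSeries :=
  MvPowerSeries.hasSubst_of_constantCoeff_zero f.constantCoeff_eq_zero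

/-- The identity mapping. -/
def id (σ : Type) : FormalMap σ σ where
  toSeries k := MvPowerSeries.X k
  constantCoeff_eq_zero k := MvPowerSeries.constantCoeff_X k

/-- The composition `g ∘ f`, given by substitution of `f` into the components of `g`. -/
def comp {σ τ υ : Type} [Finite τ] (g : FormalMap τ υ) (f : FormalMap σ τ) : FormalMap σ υ where
  toSeries k := MvPowerSeries.subst f.toSeries (g.toSeries k)
  constantCoeff_eq_zero k :=
    MvPowerSeries.constantCoeff_subst_eq_zero f.hasSubst f.constantCoeff_eq_zero
      (g.constantCoeff_eq_zero k)

/-- The complexification `(Z, ζ) ↦ (H(Z), H̄(ζ))`. The left summand indexes the variables `Z` and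
the right summand the variables `ζ` that formally replace the conjugates of `Z`. -/
def double {σ τ : Type} (H : FormalMap σ τ) : τ ⊕ τ → MvPowerSeries (σ ⊕ σ) ℂ :=
  Sum.elim
    (fun k => MvPowerSeries.subst
      (fun i => (MvPowerSeries.X (Sum.inl i) : MvPowerSeries (σ ⊕ σ) ℂ)) (H.toSeries k))
    (fun k => MvPowerSeries.subst
      (fun i => (MvPowerSeries.X (Sum.inr i) : MvPowerSeries (σ ⊕ σ) ℂ))
      (conjSeries (H.toSeries k)))

/-- The differential `dH : T^{1,0}_0 → T^{1,0}_0` at the origin, in the bases `∂/∂Z_i`. -/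
def differential {σ τ : Type} [Fintype σ] (H : FormalMap σ τ) : (σ → ℂ) →ₗ[ℂ] (τ → ℂ) :=
  Matrix.mulVecLin
    (Matrix.of fun k i => MvPowerSeries.coeff (Finsupp.single i 1) (H.toSeries k))

end FormalMap

/-- A formal generic (real) submanifold of codimension `d` through `0` in `ℂ^N`, given by defining
series `ρ(Z, ζ)`; the variables `Z` are indexed by the left and `ζ` by the right summand. -/
structure FormalGenericSubmanifold (N d : ℕ) where
  rho : Fin d → MvPowerSeries (Fin N ⊕ Fin N) ℂ
  /-- `ρ(Z, ζ) = ρ̄(ζ, Z)` -/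
  reality : ∀ j, rho j = MvPowerSeries.subst
    (fun i => (MvPowerSeries.X i.swap : MvPowerSeries (Fin N ⊕ Fin N) ℂ)) (conjSeries (rho j))
  constantCoeff_eq_zero : ∀ j, MvPowerSeries.constantCoeff (rho j) = 0
  /-- `∂_Z ρ_1(0) ∧ … ∧ ∂_Z ρ_d(0) ≠ 0` -/
  generic : LinearIndependent ℂ fun (j : Fin d) (k : Fin N) =>
    MvPowerSeries.coeff (Finsupp.single (Sum.inl k) 1) (rho j)

/-- `T^{1,0}_0 M`: the vectors `∑ v_k ∂/∂Z_k` at the origin that annihilate `ρ_1, …, ρ_d`. -/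
def FormalGenericSubmanifold.holTangent {N d : ℕ} (M : FormalGenericSubmanifold N d) :
    Submodule ℂ (Fin N → ℂ) :=
  LinearMap.ker (Matrix.mulVecLin (Matrix.of fun (j : Fin d) (k : Fin N) =>
    MvPowerSeries.coeff (Finsupp.single (Sum.inl k) 1) (M.rho j)))

/-- `H(M) ⊂ M'`: one has `ρ'(H(Z), H̄(ζ)) = c(Z, ζ) ρ(Z, ζ)` for some `d × d` matrix `c` of formal
power series. -/
def FormalMap.MapsInto {N d : ℕ} (H : FormalMap (Fin N) (Fin N))
    (M M' : FormalGenericSubmanifold N d) : Prop :=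
  ∃ c : Matrix (Fin d) (Fin d) (MvPowerSeries (Fin N ⊕ Fin N) ℂ),
    ∀ j, MvPowerSeries.subst H.double (M'.rho j) = ∑ k, c j k * M.rho k

/-- `H` is CR transversal to `M'` at `0`: `T^{1,0}_0 M' + dH(T^{1,0}_0 ℂ^N) = T^{1,0}_0 ℂ^N`. -/
def FormalMap.IsCRTransversal {N d : ℕ} (H : FormalMap (Fin N) (Fin N))
    (M' : FormalGenericSubmanifold N d) : Prop :=
  M'.holTangent ⊔ LinearMap.range H.differential = ⊤

/-- Normal coordinates for `M` at `0`. The coordinates `(z, w)` are indexed by `Fin n ⊕ Fin d`, and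
the series `Q(z, χ, τ)` has its variables `(z, (χ, τ))` indexed by `Fin n ⊕ (Fin n ⊕ Fin d)`. -/
structure NormalCoordinates {n d : ℕ} (M : FormalGenericSubmanifold (n + d) d) where
  /-- the formal change of coordinates `Z = Z(z, w)` -/
  coord : FormalMap (Fin n ⊕ Fin d) (Fin (n + d))
  /-- its formal inverse `(z, w) = (z, w)(Z)` -/
  inv : FormalMap (Fin (n + d)) (Fin n ⊕ Fin d)
  coord_comp_inv : coord.comp inv = FormalMap.id _
  inv_comp_coord : inv.comp coord = FormalMap.id _
  Q : Fin d → MvPowerSeries (Fin n ⊕ (Fin n ⊕ Fin d)) ℂ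
  /-- `ρ(Z(z, w), Z̄(χ, τ)) = a(z, w, χ, τ) (w - Q(z, χ, τ))` with an invertible matrix `a` -/
  defining : ∃ a : Matrix (Fin d) (Fin d)
      (MvPowerSeries ((Fin n ⊕ Fin d) ⊕ (Fin n ⊕ Fin d)) ℂ), IsUnit a ∧
    ∀ j, MvPowerSeries.subst coord.double (M.rho j) =
      ∑ k, a j k * (MvPowerSeries.X (Sum.inl (Sum.inr k)) -
        MvPowerSeries.subst (Sum.elim
          (fun i => (MvPowerSeries.X (Sum.inl (Sum.inl i)) :
            MvPowerSeries ((Fin n ⊕ Fin d) ⊕ (Fin n ⊕ Fin d)) ℂ))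
          (fun i => MvPowerSeries.X (Sum.inr i))) (Q k))
  /-- `Q_j(0, χ, τ) = τ_j` -/
  normal_left : ∀ j, MvPowerSeries.subst (Sum.elim (fun _ => 0)
    (fun i => (MvPowerSeries.X i : MvPowerSeries (Fin n ⊕ Fin d) ℂ))) (Q j) =
      MvPowerSeries.X (Sum.inr j)
  /-- `Q_j(z, 0, τ) = τ_j` -/
  normal_right : ∀ j, MvPowerSeries.subst (Sum.elim
    (fun i => (MvPowerSeries.X (Sum.inl i) : MvPowerSeries (Fin n ⊕ Fin d) ℂ))
    (Sum.elim (fun _ => 0) (fun k => MvPowerSeries.X (Sum.inr k)))) (Q j) =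
      MvPowerSeries.X (Sum.inr j)

namespace NormalCoordinates

variable {n d : ℕ} {M M' : FormalGenericSubmanifold (n + d) d}

/-- The series `q^j_α(χ)` in the expansion `Q^j(z, χ, 0) = ∑_α q^j_α(χ) z^α`. -/
def qCoeff (x : NormalCoordinates M) (j : Fin d) (α : Fin n →₀ ℕ) : MvPowerSeries (Fin n) ℂ :=
  fun β => MvPowerSeries.coeff (Finsupp.sumElim α (Finsupp.sumElim β 0)) (x.Q j)

/-- The essential ideal `I_M`, generated by all the `q^j_α(χ)`. -/
def essentialIdeal (x : NormalCoordinates M) : Ideal (MvPowerSeries (Fin n) ℂ) :=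
  Ideal.span {f | ∃ j α, f = x.qCoeff j α}

/-- `M` is essentially finite at `0`: the essential ideal has finite codimension. -/
def IsEssentiallyFinite (x : NormalCoordinates M) : Prop :=
  Module.Finite ℂ (MvPowerSeries (Fin n) ℂ ⧸ x.essentialIdeal)

/-- The essential type `Ess_0(M)`, i.e. the codimension of the essential ideal; it is meaningful
when `M` is essentially finite. -/
def essentialType (x : NormalCoordinates M) : ℕ :=
  Module.finrank ℂ (MvPowerSeries (Fin n) ℂ ⧸ x.essentialIdeal)

/-- The mapping `H`, written as `(F, G)` in the normal coordinates `x` (source) and `x'`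
(target). -/
def express (x : NormalCoordinates M) (x' : NormalCoordinates M')
    (H : FormalMap (Fin (n + d)) (Fin (n + d))) : FormalMap (Fin n ⊕ Fin d) (Fin n ⊕ Fin d) :=
  x'.inv.comp (H.comp x.coord)

/-- The components of `F(z, 0)`, the mapping induced by `H` between the Segre varieties. -/
def segreSeries (x : NormalCoordinates M) (x' : NormalCoordinates M')
    (H : FormalMap (Fin (n + d)) (Fin (n + d))) (i : Fin n) : MvPowerSeries (Fin n) ℂ :=
  MvPowerSeries.subst (Sum.elim
    (fun k => (MvPowerSeries.X k : MvPowerSeries (Fin n) ℂ)) (fun _ => 0))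
    ((express x x' H).toSeries (Sum.inl i))

/-- The ideal `I(F(z, 0))`. -/
def segreIdeal (x : NormalCoordinates M) (x' : NormalCoordinates M')
    (H : FormalMap (Fin (n + d)) (Fin (n + d))) : Ideal (MvPowerSeries (Fin n) ℂ) :=
  Ideal.span (Set.range (segreSeries x x' H))

/-- `H` is Segre finite: the formal mapping `z ↦ F(z, 0)` is finite. -/
def IsSegreFinite (x : NormalCoordinates M) (x' : NormalCoordinates M')
    (H : FormalMap (Fin (n + d)) (Fin (n + d))) : Prop :=
  Module.Finite ℂ (MvPowerSeries (Fin n) ℂ ⧸ segreIdeal x x' H)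

/-- The integer `m_H = dim ℂ⟦z⟧ / I(F(z, 0))`; it is meaningful when `H` is Segre finite. -/
def segreMultiplicity (x : NormalCoordinates M) (x' : NormalCoordinates M')
    (H : FormalMap (Fin (n + d)) (Fin (n + d))) : ℕ :=
  Module.finrank ℂ (MvPowerSeries (Fin n) ℂ ⧸ segreIdeal x x' H)

end NormalCoordinates

end

-- Regular sequences, depth and freeness over Noetherian local rings

universe u

/-! Normality gives G(z,0) = 0, hence also Ḡ(χ,0) = 0. Restricting the mapping equation to the
points of M with τ = 0 therefore yields G(z,Q(z,χ,0)) = Q'(F(z,Q(z,χ,0)), F̄(χ,0), 0)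
(`leafHom_express_inr`). CR transversality makes G(z,w) = B(z,w)w with B invertible, so the two
sides of B(z,Q) Q(z,χ,0) = Q'(F(z,Q), F̄(χ,0), 0) show that Q(z,χ,0) and Q'(F(z,Q), F̄(χ,0), 0)
generate the same ideal of ℂ⟦z,χ⟧ (`span_segreQ_eq`).

Let φ be the homomorphism χ' ↦ F̄(χ,0). The right-hand side has its entries in the extension of
φ(I_{M'}), so I_M lies in the ideal generated by φ(I_{M'}) (`essentialIdeal_le_map`). As I_{M'} is
contained in the maximal ideal, essential finiteness of M forces H to be Segre finite. For the
reverse inclusion, work modulo I_M: there Q(z,χ,0) vanishes, F(z,Q) becomes F(z,0), and Q'(F(z,0),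
F̄(χ,0), 0) lies in the extension of I_M. If H is Segre finite, z' ↦ F(z,0) is faithfully flat, so
F(z,0) can be replaced by the free variable z'; the coefficients in z' then give φ(I_{M'}) ⊂ I_M
(`map_le_essentialIdeal`).

Thus I_M is the extension of I_{M'} along φ. A finite formal map between spaces of equal dimension
makes the source ring a finite free module over the target ring
(`finite_and_free_of_finite_quotient`): finiteness is Nakayama over a complete ring, and freeness
holds because power series rings are regular, so that the images of the variables, being a system of
parameters, form a regular sequence. Extension of ideals multiplies codimensions by the rank, and
the rank is m_H, since conjugating coefficients does not change dimensions. -/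

theorem IsLocalRing.exists_associatedPrime_quotSMulTop {R M : Type*} [CommRing R]
    [IsLocalRing R] [IsNoetherianRing R] [AddCommGroup M] [Module R M] [Module.Finite R M]
    {x : R} (hxm : x ∈ IsLocalRing.maximalIdeal R) (hx : IsSMulRegular M x)
    {p : Ideal R} (hp : IsAssociatedPrime p M) :
    ∃ q : Ideal R, IsAssociatedPrime q (QuotSMulTop x M) ∧ p ≤ q ∧ x ∈ q := by
  open scoped Pointwise in
  obtain ⟨hpp, u, hu⟩ := isAssociatedPrime_iff.mp hp
  have hpu : ∀ a ∈ p, a • u = 0 := by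
    intro a ha
    rw [hu] at ha
    simpa [Submodule.mem_colon_singleton] using ha
  have hu0 : u ≠ 0 := by
    rintro rfl
    apply hpp.ne_top
    rw [hu, Ideal.eq_top_iff_one]
    simp [Submodule.mem_colon_singleton]
  let N : Submodule R M := Submodule.torsionBySet R M p
  have hN : ∀ v, v ∈ N ↔ ∀ a ∈ p, a • v = 0 := by
    intro v
    simp [N, Submodule.mem_torsionBySet_iff]
  -- If the submodule N of elements killed by p were contained in xM, regularity of x would give N =
  -- xN, hence N = 0 by Nakayama. The class in M/xM of an element of N outside xM is nonzero and
  -- killed by both p and x.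
  have hex : ∃ v ∈ N, v ∉ x • (⊤ : Submodule R M) := by
    by_contra! hcon
    have hle : N ≤ Ideal.span {x} • N := by
      intro v hv
      obtain ⟨w, -, rfl⟩ := (Submodule.mem_smul_pointwise_iff_exists _ _ _).mp (hcon v hv)
      refine Submodule.smul_mem_smul (Ideal.mem_span_singleton_self x) ?_
      rw [hN] at hv ⊢
      intro a ha
      apply IsSMulRegular.right_eq_zero_of_smul hx
      rw [smul_comm]
      exact hv a ha
    have hbot : N = ⊥ := by
      refine Submodule.eq_bot_of_le_smul_of_le_jacobson_bot (Ideal.span {x}) N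
        (IsNoetherian.noetherian N) hle ?_
      rw [IsLocalRing.jacobson_eq_maximalIdeal ⊥ bot_ne_top]
      exact (Ideal.span_singleton_le_iff_mem _).mpr hxm
    have : u ∈ N := (hN u).mpr hpu
    rw [hbot] at this
    exact hu0 (by simpa using this)
  obtain ⟨v, hvN, hv⟩ := hex
  have hv0 : (Submodule.Quotient.mk v : QuotSMulTop x M) ≠ 0 := by
    rwa [Ne, Submodule.Quotient.mk_eq_zero]
  obtain ⟨q, hq, hle⟩ := exists_le_isAssociatedPrime_of_isNoetherianRing R _ hv0
  refine ⟨q, hq, fun a ha => hle ?_, hle ?_⟩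
  · rw [Submodule.mem_colon_singleton, ← Submodule.Quotient.mk_smul, (hN v).mp hvN a ha]
    simp
  · rw [Submodule.mem_colon_singleton, ← Submodule.Quotient.mk_smul, Submodule.mem_bot,
      Submodule.Quotient.mk_eq_zero]
    exact Submodule.smul_mem_pointwise_smul v x ⊤ trivial

/-- Depth is bounded by the dimension of every associated prime. Dividing by the first element x
replaces p by an associated prime q of M/xM containing p and x; since x is regular it is not in p,
so the dimension drops by at least one. -/
theorem RingTheory.Sequence.IsWeaklyRegular.length_le_ringKrullDim_quotient {R : Type*}
    [CommRing R] [IsLocalRing R] [IsNoetherianRing R] (rs : List R)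
    (hrs : ∀ r ∈ rs, r ∈ IsLocalRing.maximalIdeal R) :
    ∀ {M : Type*} [AddCommGroup M] [Module R M] [Module.Finite R M],
      RingTheory.Sequence.IsWeaklyRegular M rs → ∀ {p : Ideal R}, IsAssociatedPrime p M →
        (rs.length : WithBot ℕ∞) ≤ ringKrullDim (R ⧸ p) := by
  induction rs with
  | nil =>
    intro M _ _ _ _ p hp
    have := hp.isPrime
    simpa using ringKrullDim_nonneg_of_nontrivial
  | cons x rs ih =>
    intro M _ _ _ hreg p hp
    rw [RingTheory.Sequence.isWeaklyRegular_cons_iff] at hreg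
    have hxm := hrs x List.mem_cons_self
    obtain ⟨q, hq, hpq, hxq⟩ :=
      IsLocalRing.exists_associatedPrime_quotSMulTop hxm hreg.1 hp
    have h1 := ih (fun r hr => hrs r (List.mem_cons_of_mem _ hr)) hreg.2 hq
    have := hp.isPrime
    have hxp : x ∉ p := by
      intro hxp
      obtain ⟨hpp, u, hu⟩ := isAssociatedPrime_iff.mp hp
      have hxu : x • u = 0 := by
        rw [hu] at hxp
        simpa [Submodule.mem_colon_singleton] using hxp
      apply hpp.ne_top
      rw [hu, IsSMulRegular.right_eq_zero_of_smul hreg.1 hxu, Ideal.eq_top_iff_one]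
      simp [Submodule.mem_colon_singleton]
    have h2 := ringKrullDim_succ_le_of_surjective (Ideal.Quotient.factor hpq)
      (Ideal.Quotient.factor_surjective hpq) (r := Ideal.Quotient.mk p x)
      (mem_nonZeroDivisors_of_ne_zero (by rwa [Ne, Ideal.Quotient.eq_zero_iff_mem]))
      (by simpa [Ideal.Quotient.eq_zero_iff_mem] using hxq)
    refine le_trans ?_ h2
    push_cast [List.length_cons]
    gcongr

open CategoryTheory Abelian in
-- A regular element lowers the depth by only one, even if it is not part of the given sequence.
-- Depth is detected by the vanishing of Ext from the residue field, and the long exact sequence of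
-- 0 → M → M → M/yM → 0 costs one degree.
theorem IsLocalRing.exists_isRegular_quotSMulTop {R M : Type u} [CommRing R]
    [IsLocalRing R] [IsNoetherianRing R] [AddCommGroup M] [Module R M] [Module.Finite R M]
    {n : ℕ} (h : ∃ rs : List R, rs.length = n + 1 ∧ (∀ r ∈ rs, r ∈ maximalIdeal R) ∧
      RingTheory.Sequence.IsRegular M rs)
    {y : R} (hym : y ∈ maximalIdeal R) (hy : IsSMulRegular M y) :
    ∃ rs : List R, rs.length = n ∧ (∀ r ∈ rs, r ∈ maximalIdeal R) ∧
      RingTheory.Sequence.IsRegular (QuotSMulTop y M) rs := by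
  obtain ⟨rs, hlen, hmem, hreg⟩ := h
  have := hreg.nontrivial
  have hne : ∀ (L : Type u) [AddCommGroup L] [Module R L] [Module.Finite R L] [Nontrivial L],
      maximalIdeal R • (⊤ : Submodule R L) < ⊤ := by
    intro L _ _ _ _
    refine (Submodule.top_ne_ideal_smul_of_le_jacobson_annihilator ?_).symm.lt_top
    exact (IsLocalRing.maximalIdeal_le_jacobson _)
  have : Nontrivial (QuotSMulTop y M) :=
    nontrivial_quotSMulTop_of_mem_maximalIdeal _ hym
  have hsupp : Module.support R (R ⧸ maximalIdeal R) =
      PrimeSpectrum.zeroLocus (maximalIdeal R : Set R) := by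
    rw [Module.support_eq_zeroLocus, Ideal.annihilator_quotient]
  have hext := ModuleCat.subsingleton_ext_of_exists_isRegular (maximalIdeal R)
    (ModuleCat.of R (R ⧸ maximalIdeal R)) hsupp.subset (ModuleCat.of R M) (hne M) rs hmem hreg
  refine ModuleCat.exists_isRegular_of_exists_subsingleton_ext (maximalIdeal R) n
    (ModuleCat.of R (QuotSMulTop y M)) (hne _) (ModuleCat.of R (R ⧸ maximalIdeal R)) hsupp ?_
  intro i hi
  have zero1 := AddCommGrpCat.isZero_of_iff_subsingleton.mpr (hext i (by omega))
  have zero2 := AddCommGrpCat.isZero_of_iff_subsingleton.mpr (hext (i + 1) (by omega))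
  have hy' : IsSMulRegular (ModuleCat.of R M) y := hy
  exact AddCommGrpCat.subsingleton_of_isZero <| ShortComplex.Exact.isZero_of_both_zeros
    ((Ext.covariant_sequence_exact₃' (ModuleCat.of R (R ⧸ maximalIdeal R))
      hy'.smulShortComplex_shortExact) i (i + 1) rfl)
    (zero1.eq_zero_of_src _) (zero2.eq_zero_of_tgt _)

/-- A system of parameters of a Cohen-Macaulay module is a regular sequence. -/
theorem IsLocalRing.isWeaklyRegular_of_pow_le {R : Type u} [CommRing R] [IsLocalRing R]
    [IsNoetherianRing R] (ys : List R) (hys : ∀ y ∈ ys, y ∈ maximalIdeal R) :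
    ∀ {M : Type u} [AddCommGroup M] [Module R M] [Module.Finite R M],
      (∃ rs : List R, rs.length = ys.length ∧ (∀ r ∈ rs, r ∈ maximalIdeal R) ∧
        RingTheory.Sequence.IsRegular M rs) →
      maximalIdeal R ≤ (Module.annihilator R M ⊔ Ideal.ofList ys).radical →
      RingTheory.Sequence.IsWeaklyRegular M ys := by
  induction ys with
  | nil => intros; exact .nil _ _
  | cons y ys ih =>
    intro M _ _ _ hdepth hrad
    have hym := hys y List.mem_cons_self
    have hys' : ∀ y ∈ ys, y ∈ maximalIdeal R := fun r hr => hys r (List.mem_cons_of_mem _ hr)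
    have hy : IsSMulRegular M y := by
      -- Otherwise y lies in an associated prime p. Krull's height theorem bounds dim R/p by the
      -- length of `ys`, because y vanishes in R/p, whereas the depth of M forces dim R/p to be at
      -- least one more.
      by_contra hy
      have hy' : y ∈ ⋃ p ∈ associatedPrimes R M, (p : Set R) := by
        rw [biUnion_associatedPrimes_eq_compl_regular]
        exact hy
      simp only [Set.mem_iUnion] at hy'
      obtain ⟨p, hp, hyp⟩ := hy'
      have hpass : IsAssociatedPrime p M := hp
      have := hpass.isPrime
      obtain ⟨rs, hlen, hmem, hreg⟩ := hdepth
      have h1 := RingTheory.Sequence.IsWeaklyRegular.length_le_ringKrullDim_quotient rs hmem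
        hreg.toIsWeaklyRegular hpass
      have hpm : p ≤ maximalIdeal R := IsLocalRing.le_maximalIdeal this.ne_top
      let π := Ideal.Quotient.mk p
      have hloc : IsLocalRing (R ⧸ p) :=
        IsLocalRing.of_surjective' π Ideal.Quotient.mk_surjective
      let I : Ideal (R ⧸ p) := Ideal.ofList (ys.map π)
      have hmap : maximalIdeal (R ⧸ p) ≤ I.radical := by
        intro a ha
        obtain ⟨a, rfl⟩ := Ideal.Quotient.mk_surjective a
        have ham : a ∈ maximalIdeal R := by
          by_contra hn
          have hu : IsUnit a := by simpa using hn
          exact ha (hu.map π)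
        obtain ⟨k, hk⟩ := hrad ham
        refine ⟨k, ?_⟩
        have := Ideal.mem_map_of_mem π hk
        rw [Ideal.map_sup, Ideal.map_ofList, List.map_cons, Ideal.ofList_cons] at this
        have hann : Ideal.map π (Module.annihilator R M) = ⊥ := by
          rw [Ideal.map_eq_bot_iff_le_ker, Ideal.mk_ker]
          simpa [Submodule.annihilator_top] using hpass.annihilator_le
        have hyz : π y = 0 := Ideal.Quotient.eq_zero_iff_mem.mpr hyp
        rw [hann, hyz] at this
        simpa using this
      have hmin : maximalIdeal (R ⧸ p) ∈ I.minimalPrimes := by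
        refine ⟨⟨inferInstance, ?_⟩, ?_⟩
        · refine Ideal.span_le.mpr ?_
          intro z hz
          obtain ⟨w, hw, rfl⟩ := List.mem_map.mp hz
          intro hu
          have hw' := hys' w hw
          have : π w ∈ maximalIdeal (R ⧸ p) := by
            have : IsLocalHom π := IsLocalHom.of_surjective π Ideal.Quotient.mk_surjective
            rw [IsLocalRing.mem_maximalIdeal] at hw' ⊢
            exact (map_mem_nonunits_iff π w).mpr hw'
          exact this hu
        · rintro q ⟨hq, hIq⟩ -
          exact hmap.trans (hq.radical_le_iff.mpr hIq)
      have h2 : (maximalIdeal (R ⧸ p)).height ≤ I.spanFinrank := by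
        have hI : I.spanFinrank = I.spanRank.toENat := by
          rw [Submodule.fg_iff_spanRank_eq_spanFinrank.mpr (IsNoetherian.noetherian I), map_natCast]
        rw [hI]
        exact Ideal.height_le_spanRank_toENat_of_mem_minimalPrimes _ _ hmin
      have h3 : I.spanFinrank ≤ ys.length := by
        have hfin : Set.Finite {r | r ∈ ys.map π} := List.finite_toSet _
        refine (Submodule.spanFinrank_span_le_ncard_of_finite hfin).trans ?_
        classical
        have : {r | r ∈ ys.map π} = ((ys.map π).toFinset : Set (R ⧸ p)) := by ext; simp
        rw [this, Set.ncard_coe_finset]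
        exact (List.toFinset_card_le _).trans (by simp)
      rw [← IsLocalRing.maximalIdeal_height_eq_ringKrullDim, hlen] at h1
      have h4 : ((y :: ys).length : ℕ∞) ≤ (ys.length : ℕ∞) := by
        have h5 : (((y :: ys).length : ℕ∞) : WithBot ℕ∞) ≤
          ((maximalIdeal (R ⧸ p)).height : WithBot ℕ∞) := by exact_mod_cast h1
        exact (WithBot.coe_le_coe.mp h5).trans (h2.trans (by exact_mod_cast h3))
      have : (y :: ys).length ≤ ys.length := by exact_mod_cast h4
      simp at this
    rw [RingTheory.Sequence.isWeaklyRegular_cons_iff]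
    refine ⟨hy, ih hys' (IsLocalRing.exists_isRegular_quotSMulTop hdepth hym hy) ?_⟩
    refine hrad.trans (Ideal.radical_mono (sup_le ?_ ?_))
    · exact le_sup_of_le_left
        (LinearMap.annihilator_le_of_surjective _ (Submodule.mkQ_surjective _))
    · rw [Ideal.ofList_cons]
      refine sup_le_sup_right ?_ _
      rw [Ideal.span_singleton_le_iff_mem, Module.mem_annihilator]
      intro m
      obtain ⟨m, rfl⟩ := Submodule.mkQ_surjective _ m
      rw [← map_smul, Submodule.mkQ_apply, Submodule.Quotient.mk_eq_zero]
      exact Submodule.smul_mem_pointwise_smul m y ⊤ trivial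

open IsLocalRing RingTheory.Sequence in
/-- If a regular sequence on `R` generating the maximal ideal is regular on a finite module, then
the module is free. -/
theorem Module.free_of_isWeaklyRegular (k : ℕ) : ∀ {R : Type u} [CommRing R] [IsLocalRing R]
    [IsNoetherianRing R] {M : Type u} [AddCommGroup M] [Module R M] [Module.Finite R M]
    (rs : List R), rs.length = k → Ideal.ofList rs = maximalIdeal R → IsWeaklyRegular R rs →
      IsWeaklyRegular M rs → Module.Free R M := by
  induction k with
  | zero =>
    intro R _ _ _ M _ _ _ rs hlen hm _ _
    obtain rfl := List.length_eq_zero_iff.mp hlen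
    have hf : IsField R := IsLocalRing.isField_iff_maximalIdeal_eq.mpr (by simpa using hm.symm)
    let := hf.toField
    exact Module.Free.of_divisionRing R M
  | succ k ih =>
    intro R _ _ _ M _ _ _ rs hlen hm hR hM
    obtain ⟨x, rs, rfl⟩ := List.exists_cons_of_length_eq_add_one hlen
    have hxm : x ∈ maximalIdeal R := by
      rw [← hm]
      exact Ideal.subset_span List.mem_cons_self
    have hne : Ideal.span {x} ≠ ⊤ := fun h =>
      hxm (Ideal.span_singleton_eq_top.mp h)
    have : Nontrivial (R ⧸ Ideal.span {x}) := Ideal.Quotient.nontrivial_iff.mpr hne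
    have hloc : IsLocalRing (R ⧸ Ideal.span {x}) :=
      IsLocalRing.of_surjective' (Ideal.Quotient.mk _) Ideal.Quotient.mk_surjective
    rw [isWeaklyRegular_cons_iff'] at hM hR
    have : Module.FinitePresentation R M := Module.finitePresentation_of_finite R M
    -- Freeness lifts from M/xM over R/(x) to M over R, so the induction changes the base ring.
    rw [← Module.free_quotSMulTop_iff_free R M
      (by rwa [IsLocalRing.jacobson_eq_maximalIdeal ⊥ bot_ne_top]) hM.1]
    have : Module.Finite (R ⧸ Ideal.span {x}) (QuotSMulTop x M) :=
      Module.Finite.of_restrictScalars_finite R _ _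
    refine ih (rs.map (Ideal.Quotient.mk (Ideal.span {x}))) (by simpa using hlen) ?_ ?_ hM.2
    · rw [← Ideal.map_ofList]
      have h1 : Ideal.map (Ideal.Quotient.mk (Ideal.span {x})) (Ideal.ofList (x :: rs)) =
          Ideal.map (Ideal.Quotient.mk (Ideal.span {x})) (Ideal.ofList rs) := by
        rw [Ideal.ofList_cons, Ideal.map_sup]
        simp
      rw [← h1, hm]
      exact IsLocalRing.map_maximalIdeal_of_surjective _ Ideal.Quotient.mk_surjective
    · have e : QuotSMulTop x R ≃ₗ[R] (R ⧸ Ideal.span {x}) :=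
        Submodule.quotEquivOfEq _ _ (by
          rw [← Submodule.ideal_span_singleton_smul]; simp)
      let e' : QuotSMulTop x R ≃ₗ[R ⧸ Ideal.span {x}] (R ⧸ Ideal.span {x}) :=
        { e with
          map_smul' := by
            intro r m
            obtain ⟨r, rfl⟩ := Ideal.Quotient.mk_surjective r
            exact e.map_smul r m }
      exact (e'.isWeaklyRegular_congr _).mp hR.2

/-! ### Finiteness over complete rings -/

theorem IsPrecomplete.pi {R ι : Type*} [CommRing R] [Finite ι] (I : Ideal R) [IsPrecomplete I R] :
    IsPrecomplete I (ι → R) := by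
  classical
  have := Fintype.ofFinite ι
  have key : ∀ (J : Ideal R) (v : ι → R), (∀ i, v i ∈ J) → v ∈ J • (⊤ : Submodule R (ι → R)) := by
    intro J v hv
    rw [← Finset.univ_sum_single v]
    refine Submodule.sum_mem _ fun i _ => ?_
    have : Pi.single i (v i) = v i • (Pi.single i 1 : ι → R) := by
      rw [← Pi.single_smul']; simp
    rw [this]
    exact Submodule.smul_mem_smul (hv i) trivial
  constructor
  intro f hf
  have h : ∀ i, ∃ L : R, ∀ n, f n i ≡ L [SMOD I ^ n • (⊤ : Submodule R R)] := by
    intro i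
    refine IsPrecomplete.prec' (fun n => f n i) fun {m n} hmn => ?_
    have h1 := hf hmn
    rw [SModEq.sub_mem] at h1 ⊢
    have h2 := Submodule.mem_map_of_mem (f := LinearMap.proj (R := R) (φ := fun _ : ι => R) i) h1
    rw [Submodule.map_smul''] at h2
    exact Submodule.smul_mono le_rfl le_top h2
  choose L hL using h
  refine ⟨L, fun n => ?_⟩
  rw [SModEq.sub_mem]
  refine key _ _ fun i => ?_
  have := hL i n
  rw [SModEq.sub_mem] at this
  simpa using this

/-- Nakayama's lemma over a complete ring. -/
theorem Module.Finite.of_isPrecomplete_of_isHausdorff {R M : Type*} [CommRing R] [AddCommGroup M]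
    [Module R M] (I : Ideal R) [IsPrecomplete I R] [IsHausdorff I M]
    (h : Module.Finite R (M ⧸ I • (⊤ : Submodule R M))) : Module.Finite R M := by
  obtain ⟨n, g, hg⟩ := Module.Finite.exists_fin' R (M ⧸ I • (⊤ : Submodule R M))
  obtain ⟨f, hf⟩ := Module.projective_lifting_property (Submodule.mkQ (I • (⊤ : Submodule R M))) g
    (Submodule.mkQ_surjective _)
  have := IsPrecomplete.pi (ι := Fin n) I
  exact Module.Finite.of_surjective f
    (surjective_of_mkQ_comp_surjective (I := I) (by rwa [hf]))

/-! ### Ideals and regular sequences of variables in power series rings -/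

namespace MvPowerSeries

/-- A power series lies in the ideal generated by the variables in `s` iff it vanishes when these
variables are set to zero. -/
theorem mem_span_X_image_iff {σ R : Type*} [CommRing R] [DecidableEq σ] (s : Finset σ)
    (f : MvPowerSeries σ R) :
    f ∈ Ideal.span ((X : σ → MvPowerSeries σ R) '' s) ↔
      ∀ e : σ →₀ ℕ, (∀ j ∈ s, e j = 0) → coeff e f = 0 := by
  constructor
  · intro hf
    induction hf using Submodule.span_induction with
    | mem x hx =>
      obtain ⟨j, hj, rfl⟩ := hx
      intro e he
      rw [coeff_X, if_neg]
      rintro rfl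
      simpa using he j hj
    | zero => simp
    | add x y _ _ hx hy => intro e he; rw [map_add, hx e he, hy e he, add_zero]
    | smul a x _ hx =>
      intro e he
      rw [smul_eq_mul, coeff_mul]
      refine Finset.sum_eq_zero fun p hp => ?_
      rw [hx p.2, mul_zero]
      intro j hj
      have h1 := DFunLike.congr_fun (Finset.HasAntidiagonal.mem_antidiagonal.mp hp) j
      have := he j hj
      simp only [Finsupp.add_apply] at h1
      omega
  · induction s using Finset.induction_on generalizing f with
    | empty =>
      intro h
      have : f = 0 := by
        ext e
        simpa using h e
      rw [this]
      exact zero_mem _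
    | insert a s ha ih =>
      intro h
      -- The part of f free of X a: it satisfies the induction hypothesis, and the remainder is
      -- divisible by X a.
      let g : MvPowerSeries σ R := fun e => if e a = 0 then coeff e f else 0
      have hg : ∀ e, coeff e g = if e a = 0 then coeff e f else 0 := fun e => rfl
      have h1 : g ∈ Ideal.span ((X : σ → MvPowerSeries σ R) '' s) := by
        refine ih g fun e he => ?_
        rw [hg]
        split_ifs with h0
        · refine h e fun j hj => ?_
          obtain rfl | hj := Finset.mem_insert.mp hj
          · exact h0
          · exact he j hj
        · rfl
      have h2 : (X a : MvPowerSeries σ R) ∣ f - g := by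
        rw [X_dvd_iff]
        intro e he
        rw [map_sub, hg, if_pos he, sub_self]
      have h3 : f = (f - g) + g := by ring
      rw [h3]
      refine add_mem ?_ (Ideal.span_mono (Set.image_mono (by simp)) h1)
      exact Ideal.mem_of_dvd _ h2 (Ideal.subset_span ⟨a, by simp, rfl⟩)

theorem mem_span_range_X_iff {σ R : Type*} [CommRing R] [Finite σ] (f : MvPowerSeries σ R) :
    f ∈ Ideal.span (Set.range (X : σ → MvPowerSeries σ R)) ↔ constantCoeff f = 0 := by
  classical
  have := Fintype.ofFinite σ
  have h := mem_span_X_image_iff Finset.univ f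
  rw [Finset.coe_univ, Set.image_univ] at h
  rw [h, ← coeff_zero_eq_constantCoeff_apply]
  constructor
  · intro h
    exact h 0 (by simp)
  · intro h e he
    obtain rfl : e = 0 := by ext j; exact he j (Finset.mem_univ j)
    exact h

theorem mem_maximalIdeal_iff {σ k : Type*} [Field k] (f : MvPowerSeries σ k) :
    f ∈ IsLocalRing.maximalIdeal (MvPowerSeries σ k) ↔ constantCoeff f = 0 := by
  rw [IsLocalRing.mem_maximalIdeal, mem_nonunits_iff, isUnit_iff_constantCoeff, isUnit_iff_ne_zero,
    not_not]

theorem maximalIdeal_eq_span {σ k : Type*} [Field k] [Finite σ] :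
    IsLocalRing.maximalIdeal (MvPowerSeries σ k) = Ideal.span (Set.range X) := by
  ext f
  rw [mem_maximalIdeal_iff, mem_span_range_X_iff]

/-- Multiplication by a new variable shifts exponents without changing those of the earlier
variables, so membership in the ideal of the earlier variables can be read off coefficientwise. -/
theorem isWeaklyRegular_X {σ R : Type*} [CommRing R] (l : List σ) (hl : l.Nodup) :
    RingTheory.Sequence.IsWeaklyRegular (MvPowerSeries σ R)
      (l.map (X : σ → MvPowerSeries σ R)) := by
  classical
  rw [RingTheory.Sequence.isWeaklyRegular_iff]
  intro i hi
  have hi' : i < l.length := by simpa using hi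
  rw [isSMulRegular_quotient_iff_mem_of_smul_mem]
  have hspan : Ideal.ofList ((l.map (X : σ → MvPowerSeries σ R)).take i) =
      Ideal.span (X '' ((l.take i).toFinset : Set σ)) := by
    rw [← List.map_take, Ideal.ofList]
    congr 1
    ext r
    simp only [List.mem_map, Set.mem_ofPred_eq, Set.mem_image, Finset.mem_coe, List.mem_toFinset]
  intro f hf
  rw [hspan, smul_eq_mul, Ideal.mul_top, mem_span_X_image_iff] at hf ⊢
  intro e he
  have hnot : l[i] ∉ l.take i := by
    intro hmem
    obtain ⟨j, hj, hji⟩ := List.getElem_of_mem hmem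
    rw [List.getElem_take] at hji
    have := (List.Nodup.getElem_inj_iff hl).mp hji
    simp at hj
    omega
  have h1 := hf (e + Finsupp.single l[i] 1) (by
    intro j hj
    have hne : l[i] ≠ j := by
      rintro rfl
      exact hnot (by simpa using hj)
    simp [he j hj, hne])
  rw [List.getElem_map, smul_eq_mul, add_comm, X, coeff_add_monomial_mul, one_mul] at h1
  exact h1

theorem ofList_map_toList {σ R : Type*} [CommRing R] [Fintype σ] (f : σ → R) :
    Ideal.ofList ((Finset.univ : Finset σ).toList.map f) = Ideal.span (Set.range f) := by
  rw [Ideal.ofList]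
  congr 1
  ext r
  simp

end MvPowerSeries

/-! ### Finite codimension and finite free algebras -/

/-- In a local algebra over a field, an ideal of finite codimension contains a power of every
element of the maximal ideal. -/
theorem IsLocalRing.maximalIdeal_le_radical_of_finite (k : Type*) {R : Type*} [Field k]
    [CommRing R] [IsLocalRing R] [Algebra k R] (I : Ideal R) [Module.Finite k (R ⧸ I)] :
    maximalIdeal R ≤ I.radical := by
  rw [Ideal.radical_eq_sInf]
  refine le_sInf ?_
  rintro P ⟨hIP, hP⟩
  -- A prime containing I has a finite-dimensional domain as quotient, which is a field; so the
  -- prime is the maximal ideal.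
  have : Module.Finite k (R ⧸ P) :=
    Module.Finite.of_surjective (Ideal.Quotient.factorₐ k hIP).toLinearMap
      (Ideal.Quotient.factor_surjective hIP)
  have : IsArtinianRing (R ⧸ P) := IsArtinianRing.of_finite k _
  have hmax : P.IsMaximal := Ideal.Quotient.maximal_of_isField P
    (IsArtinianRing.isField_of_isDomain _)
  exact (IsLocalRing.eq_maximalIdeal hmax).ge

/-- The extension of I is the direct sum of the copies of I along the basis. -/
theorem Module.Basis.mem_map_algebraMap_iff {A B ι : Type*} [CommRing A] [CommRing B] [Algebra A B]
    [Finite ι] (b : Module.Basis ι A B) (I : Ideal A) (x : B) :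
    x ∈ I.map (algebraMap A B) ↔ ∀ i, b.repr x i ∈ I := by
  have := Fintype.ofFinite ι
  constructor
  · intro hx i
    have h1 : x ∈ I • (⊤ : Submodule A B) := by
      rw [Ideal.smul_top_eq_map]
      exact hx
    have h2 := Submodule.mem_map_of_mem (f := b.coord i) h1
    rw [Submodule.map_smul''] at h2
    have h3 := Submodule.smul_mono le_rfl (le_top (a := Submodule.map (b.coord i) ⊤)) h2
    simpa using h3
  · intro h
    rw [← b.sum_repr x]
    refine Ideal.sum_mem _ fun i _ => ?_
    rw [Algebra.smul_def]
    exact Ideal.mul_mem_right _ _ (Ideal.mem_map_of_mem _ (h i))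

/-- The codimension of the extension of an ideal to a finite free algebra. -/
theorem Module.Basis.exists_quotient_map_equiv (k : Type*) {A B ι : Type*} [Field k] [CommRing A]
    [CommRing B] [Algebra k A] [Algebra k B] [Algebra A B] [IsScalarTower k A B] [Finite ι]
    (b : Module.Basis ι A B) (I : Ideal A) :
    Nonempty ((B ⧸ I.map (algebraMap A B)) ≃ₗ[k] (ι → A ⧸ I)) := by
  let g : B →ₗ[k] (ι → A ⧸ I) := LinearMap.pi fun i =>
    (Ideal.Quotient.mkₐ k I).toLinearMap ∘ₗ (b.coord i).restrictScalars k
  have hg : ∀ x i, g x i = Ideal.Quotient.mk I (b.repr x i) := fun x i => rfl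
  have hsurj : Function.Surjective g := by
    intro v
    choose w hw using fun i => Ideal.Quotient.mk_surjective (v i)
    refine ⟨b.equivFun.symm w, ?_⟩
    ext i
    rw [hg, ← hw i, ← Module.Basis.equivFun_apply, LinearEquiv.apply_symm_apply]
  have hker : LinearMap.ker g = (I.map (algebraMap A B)).restrictScalars k := by
    ext x
    rw [LinearMap.mem_ker, Submodule.restrictScalars_mem, b.mem_map_algebraMap_iff, funext_iff]
    simp only [hg, Pi.zero_apply, Ideal.Quotient.eq_zero_iff_mem]
  exact ⟨(Submodule.Quotient.restrictScalarsEquiv k _).symm ≪≫ₗ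
    Submodule.quotEquivOfEq _ _ hker.symm ≪≫ₗ g.quotKerEquivOfSurjective hsurj⟩

/-! ### Finite formal mappings between spaces of equal dimension -/

namespace MvPowerSeries

/-- A finite formal mapping between spaces of the same dimension makes the ring of power series in
the source a finite free module over the ring of power series in the target. -/
theorem finite_and_free_of_finite_quotient {σ τ k : Type} [Field k] [Fintype σ] [Fintype τ]
    (hcard : Fintype.card τ = Fintype.card σ) [Algebra (MvPowerSeries τ k) (MvPowerSeries σ k)]
    [IsScalarTower k (MvPowerSeries τ k) (MvPowerSeries σ k)]
    (hX : ∀ i, constantCoeff (algebraMap (MvPowerSeries τ k) (MvPowerSeries σ k) (X i)) = 0)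
    (hfin : Module.Finite k (MvPowerSeries σ k ⧸ Ideal.span (Set.range fun i =>
      algebraMap (MvPowerSeries τ k) (MvPowerSeries σ k) (X i)))) :
    Module.Finite (MvPowerSeries τ k) (MvPowerSeries σ k) ∧
      Module.Free (MvPowerSeries τ k) (MvPowerSeries σ k) := by
  let A := MvPowerSeries τ k
  let B := MvPowerSeries σ k
  let I : Ideal A := Ideal.span (Set.range X)
  have hIB : I.map (algebraMap A B) = Ideal.span (Set.range fun i => algebraMap A B (X i)) := by
    rw [Ideal.map_span, ← Set.range_comp]
    rfl
  have hle : I.map (algebraMap A B) ≤ IsLocalRing.maximalIdeal B := by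
    rw [hIB, Ideal.span_le]
    rintro _ ⟨i, rfl⟩
    exact (mem_maximalIdeal_iff _).mpr (hX i)
  have hfinite : Module.Finite A B := by
    -- Krull's intersection theorem in B supplies the separatedness required by the complete form of
    -- Nakayama's lemma.
    have h1 : IsHausdorff (I.map (algebraMap A B)) B :=
      IsHausdorff.of_isLocalRing _ _ (ne_top_of_le_ne_top (Ideal.IsPrime.ne_top inferInstance) hle)
    have h2 : IsHausdorff I B := IsHausdorff.map_algebraMap_iff.mp h1
    refine Module.Finite.of_isPrecomplete_of_isHausdorff I ?_
    have h3 : Module.Finite A (B ⧸ I.map (algebraMap A B)) := by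
      have : Module.Finite k (B ⧸ I.map (algebraMap A B)) := by rw [hIB]; exact hfin
      exact Module.Finite.of_restrictScalars_finite k A _
    have e : (B ⧸ I.map (algebraMap A B)) ≃ₗ[A] (B ⧸ I • (⊤ : Submodule A B)) :=
      (Submodule.Quotient.restrictScalarsEquiv A _).symm ≪≫ₗ
        Submodule.quotEquivOfEq _ _ (Ideal.smul_top_eq_map I).symm
    exact Module.Finite.equiv e
  refine ⟨hfinite, ?_⟩
  refine Module.free_of_isWeaklyRegular _ ((Finset.univ : Finset τ).toList.map X) rfl
    (by rw [ofList_map_toList, maximalIdeal_eq_span]) (isWeaklyRegular_X _ (Finset.nodup_toList _)) ?_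
  -- Regularity is moved to the ring B, whose own variables form a regular sequence of the same
  -- length; finite codimension makes the images of the target variables a system of parameters.
  rw [← RingTheory.Sequence.isWeaklyRegular_map_algebraMap_iff B]
  have hlist : List.map (algebraMap A B) ((Finset.univ : Finset τ).toList.map X) =
      (Finset.univ : Finset τ).toList.map fun i => algebraMap A B (X i) := by
    simp
  rw [hlist]
  refine IsLocalRing.isWeaklyRegular_of_pow_le _ ?_ ?_ ?_
  · intro y hy
    obtain ⟨i, -, rfl⟩ := List.mem_map.mp hy
    exact (mem_maximalIdeal_iff _).mpr (hX i)
  · refine ⟨(Finset.univ : Finset σ).toList.map X, by simp [hcard], ?_, ?_⟩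
    · intro y hy
      obtain ⟨i, -, rfl⟩ := List.mem_map.mp hy
      exact (mem_maximalIdeal_iff _).mpr (constantCoeff_X i)
    · refine RingTheory.Sequence.IsRegular.of_isWeaklyRegular_of_mem_maximalIdeal _ ?_
        (isWeaklyRegular_X _ (Finset.nodup_toList _))
      intro y hy
      obtain ⟨i, -, rfl⟩ := List.mem_map.mp hy
      exact (mem_maximalIdeal_iff _).mpr (constantCoeff_X i)
  · rw [ofList_map_toList]
    exact (IsLocalRing.maximalIdeal_le_radical_of_finite k _).trans
      (Ideal.radical_mono le_sup_right)

theorem finrank_quotient_span_range_X {σ k : Type*} [Field k] [Finite σ] :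
    Module.finrank k (MvPowerSeries σ k ⧸ Ideal.span (Set.range (X : σ → MvPowerSeries σ k))) =
      1 := by
  let g : MvPowerSeries σ k →ₗ[k] k := coeff 0
  have hg : ∀ f, g f = constantCoeff f := coeff_zero_eq_constantCoeff_apply
  have hsurj : Function.Surjective g := fun c => ⟨C c, by rw [hg, constantCoeff_C]⟩
  have hker : LinearMap.ker g =
      (Ideal.span (Set.range (X : σ → MvPowerSeries σ k))).restrictScalars k := by
    ext f
    rw [LinearMap.mem_ker, Submodule.restrictScalars_mem, mem_span_range_X_iff, hg]
  have e := (Submodule.Quotient.restrictScalarsEquiv k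
    (Ideal.span (Set.range (X : σ → MvPowerSeries σ k)))).symm ≪≫ₗ
    Submodule.quotEquivOfEq _ _ hker.symm ≪≫ₗ g.quotKerEquivOfSurjective hsurj
  rw [e.finrank_eq, Module.finrank_self]

/-- Extension of ideals to a finite free algebra between rings of power series multiplies
codimensions by the rank. -/
theorem finite_and_finrank_quotient_map {σ τ k : Type} [Field k] [Finite τ]
    [Algebra (MvPowerSeries τ k) (MvPowerSeries σ k)]
    [IsScalarTower k (MvPowerSeries τ k) (MvPowerSeries σ k)]
    [Module.Finite (MvPowerSeries τ k) (MvPowerSeries σ k)]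
    [Module.Free (MvPowerSeries τ k) (MvPowerSeries σ k)] (I : Ideal (MvPowerSeries τ k)) :
    (Module.Finite k (MvPowerSeries σ k ⧸
      I.map (algebraMap (MvPowerSeries τ k) (MvPowerSeries σ k))) ↔
        Module.Finite k (MvPowerSeries τ k ⧸ I)) ∧
    Module.finrank k (MvPowerSeries σ k ⧸
      I.map (algebraMap (MvPowerSeries τ k) (MvPowerSeries σ k))) =
      Module.finrank k (MvPowerSeries σ k ⧸ Ideal.span (Set.range fun i =>
        algebraMap (MvPowerSeries τ k) (MvPowerSeries σ k) (X i))) *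
        Module.finrank k (MvPowerSeries τ k ⧸ I) := by
  let b := Module.Free.chooseBasis (MvPowerSeries τ k) (MvPowerSeries σ k)
  let ι := Module.Free.ChooseBasisIndex (MvPowerSeries τ k) (MvPowerSeries σ k)
  have hι : Nonempty ι := b.index_nonempty
  have hrank : ∀ J : Ideal (MvPowerSeries τ k), Module.finrank k (MvPowerSeries σ k ⧸
      J.map (algebraMap (MvPowerSeries τ k) (MvPowerSeries σ k))) =
      Fintype.card ι * Module.finrank k (MvPowerSeries τ k ⧸ J) := by
    intro J
    obtain ⟨e⟩ := b.exists_quotient_map_equiv k J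
    rw [e.finrank_eq]
    by_cases hJ : Module.Finite k (MvPowerSeries τ k ⧸ J)
    · rw [Module.finrank_pi_fintype]
      simp [ι]
    -- In infinite dimension both `finrank`s take the default value 0; the index set must be
    -- nonempty for this.
    · have hJ' : ¬ Module.Finite k (ι → MvPowerSeries τ k ⧸ J) := by
        intro h
        obtain ⟨i⟩ := hι
        exact hJ (Module.Finite.of_surjective
          (LinearMap.proj (R := k) (φ := fun _ : ι => MvPowerSeries τ k ⧸ J) i)
          (LinearMap.proj_surjective i))
      rw [Module.finrank_of_not_finite hJ, Module.finrank_of_not_finite hJ', mul_zero]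
  -- The maximal ideal has codimension 1, so the rank equals the codimension of its extension.
  have hm := hrank (Ideal.span (Set.range X))
  rw [Ideal.map_span, ← Set.range_comp, finrank_quotient_span_range_X, mul_one] at hm
  refine ⟨⟨fun h => ?_, fun h => ?_⟩, (hrank I).trans (congrArg (· * _) hm.symm)⟩
  · obtain ⟨e⟩ := b.exists_quotient_map_equiv k I
    have h' : Module.Finite k (ι → MvPowerSeries τ k ⧸ I) := Module.Finite.equiv e
    obtain ⟨i⟩ := hι
    exact Module.Finite.of_surjective
      (LinearMap.proj (R := k) (φ := fun _ : ι => MvPowerSeries τ k ⧸ I) i)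
      (LinearMap.proj_surjective i)
  · obtain ⟨e⟩ := b.exists_quotient_map_equiv k I
    exact Module.Finite.equiv e.symm

section AlgHom

variable {σ τ k : Type} [Field k] [Fintype σ] [Fintype τ]
  (φ : MvPowerSeries τ k →ₐ[k] MvPowerSeries σ k)

/-- The ring homomorphism induced by a finite formal mapping between spaces of the same dimension
is faithfully flat, so that ideals are contractions of their extensions. -/
theorem comap_map_of_finite_quotient (hcard : Fintype.card τ = Fintype.card σ)
    (hX : ∀ i, constantCoeff (φ (X i)) = 0)
    (hfin : Module.Finite k (MvPowerSeries σ k ⧸ Ideal.span (Set.range fun i => φ (X i))))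
    (I : Ideal (MvPowerSeries τ k)) : (I.map φ).comap φ = I := by
  let _ : Algebra (MvPowerSeries τ k) (MvPowerSeries σ k) := φ.toRingHom.toAlgebra
  have : IsScalarTower k (MvPowerSeries τ k) (MvPowerSeries σ k) :=
    IsScalarTower.of_algebraMap_eq fun r => (φ.commutes r).symm
  obtain ⟨h1, h2⟩ := finite_and_free_of_finite_quotient (k := k) hcard hX hfin
  exact Ideal.comap_map_eq_self_of_faithfullyFlat I

/-- Extension of ideals along a finite formal mapping multiplies codimensions by the multiplicity
of the mapping. -/
theorem finite_and_finrank_quotient_map_algHom (hcard : Fintype.card τ = Fintype.card σ)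
    (hX : ∀ i, constantCoeff (φ (X i)) = 0)
    (hfin : Module.Finite k (MvPowerSeries σ k ⧸ Ideal.span (Set.range fun i => φ (X i))))
    (I : Ideal (MvPowerSeries τ k)) :
    (Module.Finite k (MvPowerSeries σ k ⧸ I.map φ) ↔ Module.Finite k (MvPowerSeries τ k ⧸ I)) ∧
    Module.finrank k (MvPowerSeries σ k ⧸ I.map φ) =
      Module.finrank k (MvPowerSeries σ k ⧸ Ideal.span (Set.range fun i => φ (X i))) *
        Module.finrank k (MvPowerSeries τ k ⧸ I) := by
  let _ : Algebra (MvPowerSeries τ k) (MvPowerSeries σ k) := φ.toRingHom.toAlgebra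
  have : IsScalarTower k (MvPowerSeries τ k) (MvPowerSeries σ k) :=
    IsScalarTower.of_algebraMap_eq fun r => (φ.commutes r).symm
  obtain ⟨h1, h2⟩ := finite_and_free_of_finite_quotient (k := k) hcard hX hfin
  exact finite_and_finrank_quotient_map I

end AlgHom

end MvPowerSeries

/-! ### Homomorphisms of power series rings determined on the variables -/

namespace MvPowerSeries

section AlgHom

variable {σ k : Type*} [Field k]

theorem exists_eq_C_add_sum [Fintype σ] (f : MvPowerSeries σ k) :
    ∃ g : σ → MvPowerSeries σ k, f = C (constantCoeff f) + ∑ i, g i * X i := by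
  have h : f - C (constantCoeff f) ∈ Ideal.span (Set.range (X : σ → MvPowerSeries σ k)) := by
    rw [mem_span_range_X_iff]
    simp
  obtain ⟨g, hg⟩ := (Ideal.mem_span_range_iff_exists_fun).mp h
  exact ⟨g, by rw [hg]; ring⟩

variable {B : Type*} [CommRing B] [Algebra k B]

theorem map_C_algHom (φ : MvPowerSeries σ k →ₐ[k] B) (c : k) : φ (C c) = algebraMap k B c :=
  φ.commutes c

/-- Homomorphisms from a ring of formal power series to a Noetherian local ring are determined by
the images of the variables. -/
theorem algHom_ext_of_mem_maximalIdeal [Finite σ] [IsLocalRing B] [IsNoetherianRing B]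
    {φ ψ : MvPowerSeries σ k →ₐ[k] B} (hm : ∀ i, φ (X i) ∈ IsLocalRing.maximalIdeal B)
    (h : ∀ i, φ (X i) = ψ (X i)) : φ = ψ := by
  have := Fintype.ofFinite σ
  have key : ∀ N f, φ f - ψ f ∈ IsLocalRing.maximalIdeal B ^ N := by
    intro N
    induction N with
    | zero => simp
    | succ N ih =>
      intro f
      obtain ⟨g, hg⟩ := exists_eq_C_add_sum f
      -- Equal constants cancel, and the common image of each variable supplies one more factor from
      -- the maximal ideal. Krull's intersection theorem then finishes the proof.
      have : φ f - ψ f = ∑ i, (φ (g i) - ψ (g i)) * φ (X i) := by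
        rw [hg, map_add, map_add, map_C_algHom, map_C_algHom, map_sum, map_sum, add_sub_add_left_eq_sub,
          ← Finset.sum_sub_distrib]
        refine Finset.sum_congr rfl fun i _ => ?_
        rw [map_mul, map_mul, ← h i]
        ring
      rw [this, pow_succ]
      exact Ideal.sum_mem _ fun i _ => Ideal.mul_mem_mul (ih _) (hm i)
  ext f
  rw [← sub_eq_zero, ← Ideal.mem_bot,
    ← Ideal.iInf_pow_eq_bot_of_isLocalRing (IsLocalRing.maximalIdeal B)
      (Ideal.IsPrime.ne_top inferInstance)]
  exact (Submodule.mem_iInf _).mpr fun N => key N f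

/-- This is uniqueness of homomorphisms into the local ring B/J. It replaces Taylor expansion
whenever a substitution is altered modulo an ideal. -/
theorem algHom_sub_mem_of_mem_maximalIdeal [Finite σ] [IsLocalRing B] [IsNoetherianRing B]
    {φ ψ : MvPowerSeries σ k →ₐ[k] B} (J : Ideal B)
    (hm : ∀ i, φ (X i) ∈ IsLocalRing.maximalIdeal B)
    (h : ∀ i, φ (X i) - ψ (X i) ∈ J) (f : MvPowerSeries σ k) : φ f - ψ f ∈ J := by
  by_cases hJ : J = ⊤
  · rw [hJ]; trivial
  have : Nontrivial (B ⧸ J) := Ideal.Quotient.nontrivial_iff.mpr hJ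
  have : IsLocalRing (B ⧸ J) :=
    IsLocalRing.of_surjective' (Ideal.Quotient.mk J) Ideal.Quotient.mk_surjective
  have := algHom_ext_of_mem_maximalIdeal (φ := (Ideal.Quotient.mkₐ k J).comp φ)
    (ψ := (Ideal.Quotient.mkₐ k J).comp ψ)
    (fun i => by
      rw [← IsLocalRing.map_maximalIdeal_of_surjective (Ideal.Quotient.mk J)
        Ideal.Quotient.mk_surjective]
      exact Ideal.mem_map_of_mem _ (hm i))
    (fun i => Ideal.Quotient.eq.mpr (h i))
  exact Ideal.Quotient.eq.mp (AlgHom.congr_fun this f)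

end AlgHom

section Linear

variable {σ τ k : Type*} [Field k]

theorem constantCoeff_algHom [Finite σ] {φ : MvPowerSeries σ k →ₐ[k] MvPowerSeries τ k}
    (hφ : ∀ i, constantCoeff (φ (X i)) = 0) (f : MvPowerSeries σ k) :
    constantCoeff (φ f) = constantCoeff f := by
  have := Fintype.ofFinite σ
  obtain ⟨g, hg⟩ := exists_eq_C_add_sum f
  conv_lhs => rw [hg]
  rw [map_add, map_add, map_C_algHom, map_sum, map_sum]
  simp [hφ, algebraMap_apply]

theorem coeff_single_mul (t : σ) (f g : MvPowerSeries σ k) (hg : constantCoeff g = 0) :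
    coeff (Finsupp.single t 1) (f * g) = constantCoeff f * coeff (Finsupp.single t 1) g := by
  classical
  rw [coeff_mul, Finsupp.antidiagonal_single]
  simp [Finset.Nat.antidiagonal_succ, hg]

/-- The chain rule at the origin. -/
theorem coeff_single_algHom [Fintype σ] {φ : MvPowerSeries σ k →ₐ[k] MvPowerSeries τ k}
    (hφ : ∀ i, constantCoeff (φ (X i)) = 0) (f : MvPowerSeries σ k) (t : τ) :
    coeff (Finsupp.single t 1) (φ f) =
      ∑ s, coeff (Finsupp.single s 1) f * coeff (Finsupp.single t 1) (φ (X s)) := by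
  classical
  obtain ⟨g, hg⟩ := exists_eq_C_add_sum f
  have h1 : ∀ s, coeff (Finsupp.single s 1) f = constantCoeff (g s) := by
    intro s
    conv_lhs => rw [hg]
    rw [map_add, coeff_C, if_neg (by simp), zero_add, map_sum]
    have : ∀ i, coeff (Finsupp.single s 1) (g i * X i) =
        if s = i then constantCoeff (g i) else 0 := by
      intro i
      rw [coeff_single_mul _ _ _ (constantCoeff_X i), coeff_X]
      simp [Finsupp.single_left_inj]
    simp [this]
  conv_lhs => rw [hg]
  rw [map_add, map_C_algHom, map_add, algebraMap_apply, coeff_C, if_neg (by simp), zero_add,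
    map_sum, map_sum]
  refine Finset.sum_congr rfl fun i _ => ?_
  rw [map_mul, coeff_single_mul _ _ _ (hφ i), constantCoeff_algHom hφ, h1]

end Linear

/-! ### Separating two groups of variables -/

section Sum

theorem _root_.Finsupp.sumElim_inj {α β M : Type*} [Zero M] {a a' : α →₀ M} {b b' : β →₀ M} :
    Finsupp.sumElim a b = Finsupp.sumElim a' b' ↔ a = a' ∧ b = b' :=
  ((Finsupp.sumFinsuppEquivProdFinsupp (γ := M)).symm.injective.eq_iff
    (a := (a, b)) (b := (a', b'))).trans Prod.mk_inj

variable {α β k : Type*} [Field k]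

/-- The function underlying `sumToIter`. -/
noncomputable def sumToIterFun (f : MvPowerSeries (α ⊕ β) k) : MvPowerSeries α (MvPowerSeries β k) :=
  fun a => (fun b => coeff (Finsupp.sumElim a b) f : MvPowerSeries β k)

theorem coeff_coeff_sumToIterFun (f : MvPowerSeries (α ⊕ β) k) (a : α →₀ ℕ) (b : β →₀ ℕ) :
    coeff b (coeff a (sumToIterFun f)) = coeff (Finsupp.sumElim a b) f := rfl

theorem sumToIterFun_C (c : k) : sumToIterFun (C c : MvPowerSeries (α ⊕ β) k) = C (C c) := by
  classical
  ext a b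
  rw [coeff_coeff_sumToIterFun, coeff_C, coeff_C, ← Finsupp.sumElim_zero_zero]
  simp only [Finsupp.sumElim_inj]
  by_cases ha : a = 0
  · simp [ha, coeff_C]
  · simp [ha]

theorem sumToIterFun_mul (f g : MvPowerSeries (α ⊕ β) k) :
    sumToIterFun (f * g) = sumToIterFun f * sumToIterFun g := by
  classical
  ext a b
  rw [coeff_coeff_sumToIterFun, coeff_mul, coeff_mul, map_sum]
  simp only [coeff_mul, coeff_coeff_sumToIterFun]
  rw [← Finset.sum_product']
  symm
  refine Finset.sum_bij' (fun p _ => (Finsupp.sumElim p.1.1 p.2.1, Finsupp.sumElim p.1.2 p.2.2))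
    (fun p _ => (((Finsupp.sumFinsuppEquivProdFinsupp p.1).1,
      (Finsupp.sumFinsuppEquivProdFinsupp p.2).1),
      ((Finsupp.sumFinsuppEquivProdFinsupp p.1).2,
      (Finsupp.sumFinsuppEquivProdFinsupp p.2).2))) ?_ ?_ ?_ ?_ ?_
  · rintro ⟨⟨a1, a2⟩, ⟨b1, b2⟩⟩ h
    simp only [Finset.mem_product, Finset.HasAntidiagonal.mem_antidiagonal] at h ⊢
    rw [← h.1, ← h.2]
    ext (_ | _) <;> simp
  · rintro ⟨p, q⟩ h
    simp only [Finset.mem_product, Finset.HasAntidiagonal.mem_antidiagonal] at h ⊢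
    constructor
    · ext i
      simpa using DFunLike.congr_fun h (Sum.inl i)
    · ext i
      simpa using DFunLike.congr_fun h (Sum.inr i)
  · rintro ⟨⟨a1, a2⟩, ⟨b1, b2⟩⟩ h
    simp only [Prod.mk.injEq]
    refine ⟨⟨?_, ?_⟩, ?_, ?_⟩ <;> ext i <;> simp
  · rintro ⟨p, q⟩ h
    simp only [Prod.mk.injEq]
    constructor <;> ext (_ | _) <;> simp
  · rintro ⟨⟨a1, a2⟩, ⟨b1, b2⟩⟩ h
    rfl

/-- A power series in two groups of variables, viewed as a power series in the first group with
coefficients in the power series in the second group. -/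
noncomputable def sumToIter : MvPowerSeries (α ⊕ β) k →ₐ[k] MvPowerSeries α (MvPowerSeries β k) where
  toFun := sumToIterFun
  map_one' := by rw [← map_one C, sumToIterFun_C, map_one, map_one]
  map_mul' := sumToIterFun_mul
  map_zero' := by ext a b; rfl
  map_add' f g := by ext a b; rfl
  commutes' c := by
    rw [algebraMap_apply, algebraMap_apply, algebraMap_apply]
    exact sumToIterFun_C c

theorem coeff_coeff_sumToIter (f : MvPowerSeries (α ⊕ β) k) (a : α →₀ ℕ) (b : β →₀ ℕ) :
    coeff b (coeff a (sumToIter f)) = coeff (Finsupp.sumElim a b) f := rfl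

theorem sumToIter_injective :
    Function.Injective (sumToIter : MvPowerSeries (α ⊕ β) k → _) := by
  intro f g h
  ext e
  obtain ⟨⟨a, b⟩, rfl⟩ := (Finsupp.sumFinsuppEquivProdFinsupp (γ := ℕ)).symm.surjective e
  exact congrArg (fun x => coeff b (coeff a x)) h

theorem sumToIter_surjective :
    Function.Surjective (sumToIter : MvPowerSeries (α ⊕ β) k → _) := by
  intro p
  let f : MvPowerSeries (α ⊕ β) k := fun e => coeff (Finsupp.sumFinsuppEquivProdFinsupp e).2
    (coeff (Finsupp.sumFinsuppEquivProdFinsupp e).1 p)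
  refine ⟨f, ?_⟩
  ext a b
  rw [coeff_coeff_sumToIter]
  change coeff (Finsupp.sumFinsuppEquivProdFinsupp (Finsupp.sumElim a b)).2
    (coeff (Finsupp.sumFinsuppEquivProdFinsupp (Finsupp.sumElim a b)).1 p) = _
  have : Finsupp.sumFinsuppEquivProdFinsupp (Finsupp.sumElim a b) = (a, b) :=
    (Finsupp.sumFinsuppEquivProdFinsupp (γ := ℕ)).apply_symm_apply (a, b)
  rw [this]

theorem sumToIter_X_inl (i : α) : sumToIter (X (Sum.inl i) : MvPowerSeries (α ⊕ β) k) = X i := by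
  classical
  ext a b
  rw [coeff_coeff_sumToIter, coeff_X, coeff_X, ← Finsupp.sumElim_single_zero]
  simp only [Finsupp.sumElim_inj]
  by_cases ha : a = Finsupp.single i 1
  · simp [ha, coeff_one]
  · simp [ha]

theorem sumToIter_X_inr (j : β) :
    sumToIter (X (Sum.inr j) : MvPowerSeries (α ⊕ β) k) = C (X j) := by
  classical
  ext a b
  rw [coeff_coeff_sumToIter, coeff_X, coeff_C, ← Finsupp.sumElim_zero_single]
  simp only [Finsupp.sumElim_inj]
  by_cases ha : a = 0
  · simp [ha, coeff_X]
  · simp [ha]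

end Sum

section SubstHom

variable {σ τ k : Type*} [Field k] [Finite τ]

/-- Substitution of power series without constant terms. -/
noncomputable def substHom (f : τ → MvPowerSeries σ k) (hf : ∀ i, constantCoeff (f i) = 0) :
    MvPowerSeries τ k →ₐ[k] MvPowerSeries σ k :=
  substAlgHom (hasSubst_of_constantCoeff_zero hf)

theorem substHom_apply (f : τ → MvPowerSeries σ k) (hf : ∀ i, constantCoeff (f i) = 0)
    (g : MvPowerSeries τ k) : substHom f hf g = subst f g :=
  substAlgHom_apply _ g

@[simp]
theorem substHom_X (f : τ → MvPowerSeries σ k) (hf : ∀ i, constantCoeff (f i) = 0) (i : τ) :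
    substHom f hf (X i) = f i :=
  substAlgHom_X _ i

theorem constantCoeff_substHom (f : τ → MvPowerSeries σ k) (hf : ∀ i, constantCoeff (f i) = 0)
    (g : MvPowerSeries τ k) : constantCoeff (substHom f hf g) = constantCoeff g :=
  constantCoeff_algHom (by simpa using hf) g

theorem algHom_ext_of_constantCoeff [Finite σ] {φ ψ : MvPowerSeries τ k →ₐ[k] MvPowerSeries σ k}
    (hm : ∀ i, constantCoeff (φ (X i)) = 0) (h : ∀ i, φ (X i) = ψ (X i)) : φ = ψ :=
  algHom_ext_of_mem_maximalIdeal (fun i => (mem_maximalIdeal_iff _).mpr (hm i)) h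

end SubstHom

section Ideals

variable {α β k : Type} [Field k] [Finite β]

/-- The inclusion of the power series in the second group of variables. -/
noncomputable def inrHom (α : Type) {β k : Type} [Field k] [Finite β] :
    MvPowerSeries β k →ₐ[k] MvPowerSeries (α ⊕ β) k :=
  substHom (fun j => X (Sum.inr j)) fun _ => constantCoeff_X _

@[simp]
theorem inrHom_X (j : β) : inrHom α (X j : MvPowerSeries β k) = X (Sum.inr j) :=
  substHom_X _ _ _

theorem sumToIter_inrHom [Finite α] (r : MvPowerSeries β k) :
    sumToIter (inrHom α r : MvPowerSeries (α ⊕ β) k) = C r := by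
  have h : sumToIter.comp (inrHom α : MvPowerSeries β k →ₐ[k] MvPowerSeries (α ⊕ β) k) =
      IsScalarTower.toAlgHom k (MvPowerSeries β k) (MvPowerSeries α (MvPowerSeries β k)) := by
    refine algHom_ext_of_mem_maximalIdeal (fun i => ?_) fun i => ?_
    · rw [AlgHom.comp_apply, inrHom_X, sumToIter_X_inr, IsLocalRing.mem_maximalIdeal,
        mem_nonunits_iff, isUnit_iff_constantCoeff, constantCoeff_C, isUnit_iff_constantCoeff,
        constantCoeff_X]
      exact not_isUnit_zero
    · rw [AlgHom.comp_apply, inrHom_X, sumToIter_X_inr]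
      rfl
  exact AlgHom.congr_fun h r

/-- A power series lies in the extension of an ideal in the second group of variables iff all its
coefficients with respect to the first group of variables lie in the ideal. -/
theorem mem_map_inrHom_iff [Finite α] (K : Ideal (MvPowerSeries β k)) (f : MvPowerSeries (α ⊕ β) k) :
    f ∈ K.map (inrHom α) ↔ ∀ a, coeff a (sumToIter f) ∈ K := by
  constructor
  · intro hf a
    -- Reduction of all coefficients modulo K kills the extension of K.
    have hle : K.map (inrHom α) ≤ RingHom.ker ((map (Ideal.Quotient.mk K)).comp
        (sumToIter : MvPowerSeries (α ⊕ β) k →ₐ[k] _).toRingHom) := by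
      rw [Ideal.map_le_iff_le_comap]
      intro r hr
      rw [Ideal.mem_comap, RingHom.mem_ker]
      change map (Ideal.Quotient.mk K) (sumToIter (inrHom α r)) = 0
      rw [sumToIter_inrHom, map_C, Ideal.Quotient.eq_zero_iff_mem.mpr hr, map_zero]
    have h := congrArg (coeff a) (RingHom.mem_ker.mp (hle hf))
    exact Ideal.Quotient.eq_zero_iff_mem.mp (by simpa using h)
  · intro h
    -- Finite generation of K is essential: infinitely many coefficients are written with the same
    -- finitely many generators, and their multipliers are assembled into power series.
    obtain ⟨m, v, rfl⟩ := Submodule.fg_iff_exists_fin_generating_family.mp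
      (IsNoetherian.noetherian K)
    choose c hc using fun a => Ideal.mem_span_range_iff_exists_fun.mp (h a)
    have hex : ∀ i : Fin m, ∃ g : MvPowerSeries (α ⊕ β) k, ∀ a, coeff a (sumToIter g) = c a i := by
      intro i
      let p : MvPowerSeries α (MvPowerSeries β k) := fun a => c a i
      obtain ⟨g, hg⟩ := sumToIter_surjective p
      exact ⟨g, fun a => congrArg (coeff a) hg⟩
    choose g hg using hex
    have hf : f = ∑ i, g i * inrHom α (v i) := by
      apply sumToIter_injective
      ext a : 1
      rw [← hc a, map_sum, map_sum]
      refine Finset.sum_congr rfl fun i _ => ?_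
      rw [map_mul, sumToIter_inrHom, coeff_mul_C, hg]
    rw [hf]
    exact Ideal.sum_mem _ fun i _ =>
      Ideal.mul_mem_left _ _ (Ideal.mem_map_of_mem _ (Ideal.subset_span ⟨i, rfl⟩))

end Ideals

end MvPowerSeries

namespace MvPowerSeries

/-- The inclusion of the power series in the first group of variables. -/
noncomputable def inlHom {α : Type} (β : Type) {k : Type} [Field k] [Finite α] :
    MvPowerSeries α k →ₐ[k] MvPowerSeries (α ⊕ β) k :=
  substHom (fun j => X (Sum.inl j)) fun _ => constantCoeff_X _

@[simp]
theorem inlHom_X {α β k : Type} [Field k] [Finite α] (j : α) :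
    inlHom β (X j : MvPowerSeries α k) = X (Sum.inl j) :=
  substHom_X _ _ _

end MvPowerSeries

theorem constantCoeff_conjSeries {σ : Type} (f : MvPowerSeries σ ℂ) :
    MvPowerSeries.constantCoeff (conjSeries f) =
      starRingEnd ℂ (MvPowerSeries.constantCoeff f) := by
  rw [conjSeries, MvPowerSeries.constantCoeff_map]

/-! ### Composition, complexification and differentials of formal maps -/

namespace FormalMap

open MvPowerSeries

variable {σ τ υ : Type}

/-- The mapping `H̄`, whose components are the complex conjugates of the components of `H`. -/
noncomputable def conj (H : FormalMap σ τ) : FormalMap σ τ where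
  toSeries k := conjSeries (H.toSeries k)
  constantCoeff_eq_zero k := by
    rw [constantCoeff_conjSeries, H.constantCoeff_eq_zero, map_zero]

/-- The homomorphism of rings of power series induced by a formal mapping. -/
noncomputable def toHom [Finite τ] (H : FormalMap σ τ) :
    MvPowerSeries τ ℂ →ₐ[ℂ] MvPowerSeries σ ℂ :=
  substHom H.toSeries H.constantCoeff_eq_zero

@[simp]
theorem toHom_X [Finite τ] (H : FormalMap σ τ) (k : τ) : H.toHom (X k) = H.toSeries k :=
  substHom_X _ _ _

theorem comp_toSeries [Finite τ] (g : FormalMap τ υ) (f : FormalMap σ τ) (k : υ) :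
    (g.comp f).toSeries k = f.toHom (g.toSeries k) :=
  (substHom_apply _ _ _).symm

theorem conj_comp [Finite τ] (g : FormalMap τ υ) (f : FormalMap σ τ) :
    (g.comp f).conj = g.conj.comp f.conj := by
  ext1
  funext k
  exact map_subst f.hasSubst (g.toSeries k)

variable [Finite σ]

theorem double_inl (H : FormalMap σ τ) (k : τ) :
    H.double (Sum.inl k) = inlHom σ (H.toSeries k) :=
  (substHom_apply _ _ _).symm

theorem double_inr (H : FormalMap σ τ) (k : τ) :
    H.double (Sum.inr k) = inrHom σ (H.conj.toSeries k) :=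
  (substHom_apply _ _ _).symm

theorem constantCoeff_double (H : FormalMap σ τ) (k : τ ⊕ τ) : constantCoeff (H.double k) = 0 := by
  cases k with
  | inl k => rw [double_inl, inlHom, constantCoeff_substHom, H.constantCoeff_eq_zero]
  | inr k => rw [double_inr, inrHom, constantCoeff_substHom, H.conj.constantCoeff_eq_zero]

variable [Finite τ]

/-- The homomorphism of rings of power series induced by the complexification. -/
noncomputable def doubleHom (H : FormalMap σ τ) :
    MvPowerSeries (τ ⊕ τ) ℂ →ₐ[ℂ] MvPowerSeries (σ ⊕ σ) ℂ :=
  substHom H.double H.constantCoeff_double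

@[simp]
theorem doubleHom_X (H : FormalMap σ τ) (k : τ ⊕ τ) : H.doubleHom (X k) = H.double k :=
  substHom_X _ _ _

theorem doubleHom_inlHom (H : FormalMap σ τ) (f : MvPowerSeries τ ℂ) :
    H.doubleHom (inlHom τ f) = inlHom σ (H.toHom f) := by
  have h : H.doubleHom.comp (inlHom τ) = (inlHom σ).comp H.toHom :=
    algHom_ext_of_constantCoeff
      (fun i => by
        rw [AlgHom.comp_apply, inlHom_X, doubleHom_X, constantCoeff_double])
      (fun i => by
        rw [AlgHom.comp_apply, AlgHom.comp_apply, inlHom_X, doubleHom_X, double_inl, toHom_X])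
  exact AlgHom.congr_fun h f

theorem doubleHom_inrHom (H : FormalMap σ τ) (f : MvPowerSeries τ ℂ) :
    H.doubleHom (inrHom τ f) = inrHom σ (H.conj.toHom f) := by
  have h : H.doubleHom.comp (inrHom τ) = (inrHom σ).comp H.conj.toHom :=
    algHom_ext_of_constantCoeff
      (fun i => by
        rw [AlgHom.comp_apply, inrHom_X, doubleHom_X, constantCoeff_double])
      (fun i => by
        rw [AlgHom.comp_apply, AlgHom.comp_apply, inrHom_X, doubleHom_X, double_inr, toHom_X])
  exact AlgHom.congr_fun h f

theorem doubleHom_comp [Finite υ] (g : FormalMap τ υ) (f : FormalMap σ τ) :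
    (g.comp f).doubleHom = f.doubleHom.comp g.doubleHom := by
  refine algHom_ext_of_constantCoeff (fun i => by rw [doubleHom_X, constantCoeff_double]) ?_
  rintro (i | i)
  · rw [AlgHom.comp_apply, doubleHom_X, doubleHom_X, double_inl, double_inl, doubleHom_inlHom,
      comp_toSeries]
  · rw [AlgHom.comp_apply, doubleHom_X, doubleHom_X, double_inr, double_inr, doubleHom_inrHom,
      conj_comp, comp_toSeries]

theorem toHom_comp [Finite υ] (g : FormalMap τ υ) (f : FormalMap σ τ) :
    (g.comp f).toHom = f.toHom.comp g.toHom := by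
  refine algHom_ext_of_constantCoeff (fun i => by rw [toHom_X, constantCoeff_eq_zero]) fun i => ?_
  rw [AlgHom.comp_apply, toHom_X, toHom_X, comp_toSeries]

theorem comp_assoc {ω : Type} [Finite υ] (h : FormalMap υ ω) (g : FormalMap τ υ)
    (f : FormalMap σ τ) : (h.comp g).comp f = h.comp (g.comp f) := by
  ext1
  funext k
  rw [comp_toSeries, comp_toSeries, comp_toSeries, toHom_comp, AlgHom.comp_apply]

/-- The chain rule. -/
theorem differential_comp {σ τ υ : Type} [Fintype σ] [Fintype τ] (g : FormalMap τ υ)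
    (f : FormalMap σ τ) : (g.comp f).differential = g.differential ∘ₗ f.differential := by
  rw [differential, differential, differential, ← Matrix.mulVecLin_mul]
  congr 1
  ext k i
  rw [Matrix.mul_apply, Matrix.of_apply, comp_toSeries, coeff_single_algHom
    (by intro i; rw [toHom_X, f.constantCoeff_eq_zero])]
  simp

theorem differential_id {σ : Type} [Fintype σ] :
    (FormalMap.id σ).differential = LinearMap.id := by
  classical
  rw [differential, ← Matrix.mulVecLin_one]
  congr 1
  ext k i
  rw [Matrix.of_apply, FormalMap.id, coeff_X, Matrix.one_apply]
  simp [Finsupp.single_left_inj, eq_comm]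

end FormalMap

/-! ### The mapping equation in normal coordinates -/

namespace NormalCoordinates

open MvPowerSeries

variable {n d : ℕ} {M M' : FormalGenericSubmanifold (n + d) d}

/-- The inclusion of the power series in `(z, χ, τ)` into those in `(z, w, χ, τ)`. -/
noncomputable def toAmbient {n d : ℕ} : MvPowerSeries (Fin n ⊕ (Fin n ⊕ Fin d)) ℂ →ₐ[ℂ]
    MvPowerSeries ((Fin n ⊕ Fin d) ⊕ (Fin n ⊕ Fin d)) ℂ :=
  substHom (Sum.elim (fun i => X (Sum.inl (Sum.inl i))) (fun i => X (Sum.inr i)))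
    (by rintro (i | i) <;> exact constantCoeff_X _)

@[simp]
theorem toAmbient_X_inl (i : Fin n) :
    toAmbient (X (Sum.inl i) : MvPowerSeries (Fin n ⊕ (Fin n ⊕ Fin d)) ℂ) =
      X (Sum.inl (Sum.inl i)) := by
  rw [toAmbient, substHom_X]; rfl

@[simp]
theorem toAmbient_X_inr (i : Fin n ⊕ Fin d) :
    toAmbient (X (Sum.inr i) : MvPowerSeries (Fin n ⊕ (Fin n ⊕ Fin d)) ℂ) = X (Sum.inr i) := by
  rw [toAmbient, substHom_X]; rfl

/-- The series `w_k - Q_k(z, χ, τ)` defining `M` in normal coordinates. -/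
noncomputable def graph (x : NormalCoordinates M) (k : Fin d) :
    MvPowerSeries ((Fin n ⊕ Fin d) ⊕ (Fin n ⊕ Fin d)) ℂ :=
  X (Sum.inl (Sum.inr k)) - toAmbient (x.Q k)

theorem exists_doubleHom_rho (x : NormalCoordinates M) :
    ∃ a : Matrix (Fin d) (Fin d) (MvPowerSeries ((Fin n ⊕ Fin d) ⊕ (Fin n ⊕ Fin d)) ℂ),
      IsUnit a ∧ ∀ j, x.coord.doubleHom (M.rho j) = ∑ k, a j k * x.graph k := by
  obtain ⟨a, ha, h⟩ := x.defining
  refine ⟨a, ha, fun j => ?_⟩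
  rw [FormalMap.doubleHom, substHom_apply, h]
  refine Finset.sum_congr rfl fun k _ => ?_
  rw [graph, toAmbient, substHom_apply]

/-- In normal coordinates, the pullback of the defining series of the target lies in the ideal of
the source. -/
theorem doubleHom_express_graph_mem (x : NormalCoordinates M) (x' : NormalCoordinates M')
    {H : FormalMap (Fin (n + d)) (Fin (n + d))} (hH : H.MapsInto M M') (k : Fin d) :
    (express x x' H).doubleHom (x'.graph k) ∈ Ideal.span (Set.range x.graph) := by
  obtain ⟨a, -, ha⟩ := x.exists_doubleHom_rho
  obtain ⟨a', hunit, ha'⟩ := x'.exists_doubleHom_rho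
  obtain ⟨c, hc⟩ := hH
  have hcomp : (express x x' H).doubleHom.comp x'.coord.doubleHom =
      x.coord.doubleHom.comp H.doubleHom := by
    rw [← FormalMap.doubleHom_comp, ← FormalMap.doubleHom_comp, express, ← FormalMap.comp_assoc,
      x'.coord_comp_inv]
    congr 1
    ext1
    funext i
    rw [FormalMap.comp_toSeries]
    exact FormalMap.toHom_X _ _
  have hmem : ∀ j, (express x x' H).doubleHom (x'.coord.doubleHom (M'.rho j)) ∈
      Ideal.span (Set.range x.graph) := by
    intro j
    have h1 := AlgHom.congr_fun hcomp (M'.rho j)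
    rw [AlgHom.comp_apply, AlgHom.comp_apply] at h1
    have h2 : H.doubleHom (M'.rho j) = ∑ k, c j k * M.rho k :=
      (substHom_apply _ _ _).trans (hc j)
    rw [h1, h2, map_sum]
    refine Ideal.sum_mem _ fun k _ => ?_
    rw [map_mul, ha]
    refine Ideal.mul_mem_left _ _ (Ideal.sum_mem _ fun l _ => Ideal.mul_mem_left _ _ ?_)
    exact Ideal.subset_span ⟨l, rfl⟩
  -- Invertibility of the matrix a' lets each w' − Q' be recovered from the pulled-back defining
  -- series.
  obtain ⟨b, hb⟩ := hunit.exists_left_inv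
  have hgraph : x'.graph k = ∑ j, b k j * x'.coord.doubleHom (M'.rho j) := by
    simp only [ha', Finset.mul_sum, ← mul_assoc]
    rw [Finset.sum_comm]
    simp only [← Finset.sum_mul, ← Matrix.mul_apply, hb, Matrix.one_apply]
    simp
  rw [hgraph, map_sum]
  refine Ideal.sum_mem _ fun j _ => ?_
  rw [map_mul]
  exact Ideal.mul_mem_left _ _ (hmem j)

end NormalCoordinates

/-! ### Restriction of the mapping equation to Segre varieties -/

namespace NormalCoordinates

open MvPowerSeries

variable {n d : ℕ} {M M' : FormalGenericSubmanifold (n + d) d}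

/-- Restriction to `w = 0`. -/
noncomputable def axisHom {n d : ℕ} : MvPowerSeries (Fin n ⊕ Fin d) ℂ →ₐ[ℂ] MvPowerSeries (Fin n) ℂ :=
  substHom (Sum.elim X fun _ => 0) (by rintro (i | i) <;> simp)

@[simp]
theorem axisHom_X_inl (i : Fin n) :
    axisHom (X (Sum.inl i) : MvPowerSeries (Fin n ⊕ Fin d) ℂ) = X i := by
  rw [axisHom, substHom_X]; rfl

@[simp]
theorem axisHom_X_inr (k : Fin d) :
    axisHom (X (Sum.inr k) : MvPowerSeries (Fin n ⊕ Fin d) ℂ) = 0 := by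
  rw [axisHom, substHom_X]; rfl

theorem constantCoeff_axisHom (f : MvPowerSeries (Fin n ⊕ Fin d) ℂ) :
    constantCoeff (axisHom f) = constantCoeff f :=
  constantCoeff_substHom _ _ _

theorem segreSeries_eq (x : NormalCoordinates M) (x' : NormalCoordinates M')
    (H : FormalMap (Fin (n + d)) (Fin (n + d))) (i : Fin n) :
    segreSeries x x' H i = axisHom ((express x x' H).toSeries (Sum.inl i)) :=
  (substHom_apply _ _ _).symm

/-- The homomorphism setting `τ = 0`. -/
noncomputable def segreHom {n d : ℕ} : MvPowerSeries (Fin n ⊕ (Fin n ⊕ Fin d)) ℂ →ₐ[ℂ]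
    MvPowerSeries (Fin n ⊕ Fin n) ℂ :=
  substHom (Sum.elim (fun i => X (Sum.inl i)) (Sum.elim (fun i => X (Sum.inr i)) fun _ => 0))
    (by rintro (i | i | i) <;> simp)

@[simp]
theorem segreHom_X_inl (i : Fin n) :
    segreHom (X (Sum.inl i) : MvPowerSeries (Fin n ⊕ (Fin n ⊕ Fin d)) ℂ) = X (Sum.inl i) := by
  rw [segreHom, substHom_X]; rfl

@[simp]
theorem segreHom_X_inr_inl (i : Fin n) :
    segreHom (X (Sum.inr (Sum.inl i)) : MvPowerSeries (Fin n ⊕ (Fin n ⊕ Fin d)) ℂ) =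
      X (Sum.inr i) := by
  rw [segreHom, substHom_X]; rfl

@[simp]
theorem segreHom_X_inr_inr (k : Fin d) :
    segreHom (X (Sum.inr (Sum.inr k)) : MvPowerSeries (Fin n ⊕ (Fin n ⊕ Fin d)) ℂ) = 0 := by
  rw [segreHom, substHom_X]; rfl

/-- The homomorphism setting `χ = 0` and `τ = 0`. -/
noncomputable def originHom {n d : ℕ} : MvPowerSeries (Fin n ⊕ (Fin n ⊕ Fin d)) ℂ →ₐ[ℂ]
    MvPowerSeries (Fin n) ℂ :=
  substHom (Sum.elim X fun _ => 0) (by rintro (i | i) <;> simp)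

@[simp]
theorem originHom_X_inl (i : Fin n) :
    originHom (X (Sum.inl i) : MvPowerSeries (Fin n ⊕ (Fin n ⊕ Fin d)) ℂ) = X i := by
  rw [originHom, substHom_X]; rfl

@[simp]
theorem originHom_X_inr (i : Fin n ⊕ Fin d) :
    originHom (X (Sum.inr i) : MvPowerSeries (Fin n ⊕ (Fin n ⊕ Fin d)) ℂ) = 0 := by
  rw [originHom, substHom_X]; rfl

/-- `Q(z, 0, 0) = 0` -/
theorem originHom_Q (x : NormalCoordinates M) (k : Fin d) : originHom (x.Q k) = 0 := by
  let φ : MvPowerSeries (Fin n ⊕ (Fin n ⊕ Fin d)) ℂ →ₐ[ℂ] MvPowerSeries (Fin n ⊕ Fin d) ℂ :=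
    substHom (Sum.elim (fun i => X (Sum.inl i)) (Sum.elim (fun _ => 0) fun k => X (Sum.inr k)))
      (by rintro (i | i | i) <;> simp)
  have hφ : φ (x.Q k) = X (Sum.inr k) := (substHom_apply _ _ _).trans (x.normal_right k)
  have h : originHom = axisHom.comp φ := by
    refine algHom_ext_of_constantCoeff ?_ ?_
    · rintro (i | i) <;> simp
    · rintro (i | i | i) <;> simp [φ]
  rw [h, AlgHom.comp_apply, hφ, axisHom_X_inr]

theorem constantCoeff_Q (x : NormalCoordinates M) (k : Fin d) : constantCoeff (x.Q k) = 0 := by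
  have h := constantCoeff_substHom (Sum.elim X fun _ => 0)
    (by rintro (i | i) <;> simp) (x.Q k) (σ := Fin n)
  rw [← h]
  exact (congrArg constantCoeff (x.originHom_Q k)).trans (map_zero _)

/-- The series `Q_k(z, χ, 0)`. -/
noncomputable def segreQ (x : NormalCoordinates M) (k : Fin d) :
    MvPowerSeries (Fin n ⊕ Fin n) ℂ :=
  segreHom (x.Q k)

theorem constantCoeff_segreQ (x : NormalCoordinates M) (k : Fin d) :
    constantCoeff (x.segreQ k) = 0 :=
  (constantCoeff_substHom _ _ _).trans (x.constantCoeff_Q k)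

/-- The fundamental identity `G(z, Q) = Q'(F(z, Q), F̄(χ, τ), Ḡ(χ, τ))` along any parametrization
of a part of `M`. -/
theorem map_express_eq {σ : Type} (x : NormalCoordinates M) (x' : NormalCoordinates M')
    {H : FormalMap (Fin (n + d)) (Fin (n + d))} (hH : H.MapsInto M M')
    (φ : MvPowerSeries ((Fin n ⊕ Fin d) ⊕ (Fin n ⊕ Fin d)) ℂ →ₐ[ℂ] MvPowerSeries σ ℂ)
    (hφ : ∀ k, φ (X (Sum.inl (Sum.inr k))) = φ (toAmbient (x.Q k))) (k : Fin d) :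
    φ (inlHom _ ((express x x' H).toSeries (Sum.inr k))) =
      φ ((express x x' H).doubleHom (toAmbient (x'.Q k))) := by
  have hle : Ideal.span (Set.range x.graph) ≤ RingHom.ker φ := by
    rw [Ideal.span_le]
    rintro _ ⟨l, rfl⟩
    change φ (x.graph l) = 0
    rw [graph, map_sub, hφ, sub_self]
  have h : φ ((express x x' H).doubleHom (x'.graph k)) = 0 :=
    hle (doubleHom_express_graph_mem x x' hH k)
  rw [graph, map_sub, map_sub, FormalMap.doubleHom_X, FormalMap.double_inl, sub_eq_zero] at h
  exact h

/-- `G(z, 0) = 0` -/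
theorem axisHom_express_inr (x : NormalCoordinates M) (x' : NormalCoordinates M')
    {H : FormalMap (Fin (n + d)) (Fin (n + d))} (hH : H.MapsInto M M') (k : Fin d) :
    axisHom ((express x x' H).toSeries (Sum.inr k)) = 0 := by
  -- The points (z,0,0,0) lie on M because Q(z,0,0) = 0.
  let φ : MvPowerSeries ((Fin n ⊕ Fin d) ⊕ (Fin n ⊕ Fin d)) ℂ →ₐ[ℂ] MvPowerSeries (Fin n) ℂ :=
    substHom (Sum.elim (Sum.elim X fun _ => 0) fun _ => 0) (by rintro ((i | i) | i) <;> simp)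
  have h1 : φ.comp toAmbient = originHom := by
    refine algHom_ext_of_constantCoeff ?_ ?_
    · rintro (i | i) <;> simp [φ]
    · rintro (i | i) <;> simp [φ]
  have h2 : φ.comp (inlHom _) = axisHom := by
    refine algHom_ext_of_constantCoeff ?_ ?_
    · rintro (i | i) <;> simp [φ]
    · rintro (i | i) <;> simp [φ]
  have h3 : ∀ f, φ (inrHom _ f) = algebraMap ℂ _ (constantCoeff f) := by
    intro f
    have : φ.comp (inrHom _) = substHom (fun _ => 0) (fun _ => map_zero _) := by
      refine algHom_ext_of_constantCoeff ?_ ?_ <;> intro i <;> simp [φ]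
    rw [← AlgHom.comp_apply, this, substHom_apply]
    exact subst_zero_eq_C_constantCoeff
  -- At χ = τ = 0 the conjugate components vanish, so the right-hand side is Q'(F(z,0),0,0) = 0.
  have h4 : (φ.comp (express x x' H).doubleHom).comp toAmbient =
      (substHom (segreSeries x x' H) (fun i => by
        rw [segreSeries_eq, constantCoeff_axisHom, FormalMap.constantCoeff_eq_zero])).comp
        originHom := by
    have hX : ∀ i, ((φ.comp (express x x' H).doubleHom).comp toAmbient) (X i) =
        ((substHom (segreSeries x x' H) (fun i => by
        rw [segreSeries_eq, constantCoeff_axisHom, FormalMap.constantCoeff_eq_zero])).comp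
        originHom) (X i) := by
      rintro (i | i)
      · simp only [AlgHom.comp_apply, toAmbient_X_inl, originHom_X_inl, FormalMap.doubleHom_X,
          FormalMap.double_inl, substHom_X, segreSeries_eq]
        exact AlgHom.congr_fun h2 _
      · simp only [AlgHom.comp_apply, toAmbient_X_inr, originHom_X_inr, FormalMap.doubleHom_X,
          FormalMap.double_inr, h3, FormalMap.constantCoeff_eq_zero, map_zero]
    refine algHom_ext_of_constantCoeff (fun i => ?_) hX
    rw [hX]
    rcases i with i | i
    · simp [segreSeries_eq, constantCoeff_axisHom, FormalMap.constantCoeff_eq_zero]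
    · simp
  have h5 := map_express_eq x x' hH φ (fun k => by
    rw [← AlgHom.comp_apply φ toAmbient, h1, originHom_Q]
    simp [φ]) k
  rw [← AlgHom.comp_apply φ (inlHom _), h2] at h5
  rw [h5]
  have h6 := AlgHom.congr_fun h4 (x'.Q k)
  rw [AlgHom.comp_apply, AlgHom.comp_apply, AlgHom.comp_apply, originHom_Q, map_zero] at h6
  exact h6

theorem conjSeries_axisHom (f : MvPowerSeries (Fin n ⊕ Fin d) ℂ) :
    conjSeries (axisHom f) = axisHom (conjSeries f) := by
  rw [axisHom, substHom_apply, substHom_apply, conjSeries, map_subst (hasSubst_of_constantCoeff_zero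
    (by rintro (i | i) <;> simp))]
  congr 1
  funext i
  rcases i with i | i <;> simp

/-- Substitution of `w = Q(z, χ, 0)`. -/
noncomputable def leafHom (x : NormalCoordinates M) :
    MvPowerSeries (Fin n ⊕ Fin d) ℂ →ₐ[ℂ] MvPowerSeries (Fin n ⊕ Fin n) ℂ :=
  substHom (Sum.elim (fun i => X (Sum.inl i)) x.segreQ)
    (by rintro (i | i) <;> simp [constantCoeff_segreQ])

@[simp]
theorem leafHom_X_inl (x : NormalCoordinates M) (i : Fin n) :
    x.leafHom (X (Sum.inl i)) = X (Sum.inl i) := by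
  rw [leafHom, substHom_X]; rfl

@[simp]
theorem leafHom_X_inr (x : NormalCoordinates M) (k : Fin d) :
    x.leafHom (X (Sum.inr k)) = x.segreQ k := by
  rw [leafHom, substHom_X]; rfl

theorem constantCoeff_leafHom (x : NormalCoordinates M) (f : MvPowerSeries (Fin n ⊕ Fin d) ℂ) :
    constantCoeff (x.leafHom f) = constantCoeff f :=
  constantCoeff_substHom _ _ _

theorem constantCoeff_inrHom {α β : Type} [Finite β] (f : MvPowerSeries β ℂ) :
    constantCoeff (inrHom α f) = constantCoeff f :=
  constantCoeff_substHom _ _ _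

theorem constantCoeff_segreSeries (x : NormalCoordinates M) (x' : NormalCoordinates M')
    (H : FormalMap (Fin (n + d)) (Fin (n + d))) (i : Fin n) :
    constantCoeff (segreSeries x x' H i) = 0 := by
  rw [segreSeries_eq, constantCoeff_axisHom, FormalMap.constantCoeff_eq_zero]

/-- The homomorphism `z' ↦ F(z, Q(z, χ, 0))`, `χ' ↦ F̄(χ, 0)`. -/
noncomputable def leafMapHom (x : NormalCoordinates M) (x' : NormalCoordinates M')
    (H : FormalMap (Fin (n + d)) (Fin (n + d))) :
    MvPowerSeries (Fin n ⊕ Fin n) ℂ →ₐ[ℂ] MvPowerSeries (Fin n ⊕ Fin n) ℂ :=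
  substHom (Sum.elim (fun i => x.leafHom ((express x x' H).toSeries (Sum.inl i)))
    (fun i => inrHom _ (conjSeries (segreSeries x x' H i))))
    (by rintro (i | i) <;> simp [constantCoeff_leafHom, FormalMap.constantCoeff_eq_zero,
          constantCoeff_inrHom, constantCoeff_conjSeries, constantCoeff_segreSeries])

/-- `G(z, Q(z, χ, 0)) = Q'(F(z, Q(z, χ, 0)), F̄(χ, 0), 0)` -/
theorem leafHom_express_inr (x : NormalCoordinates M) (x' : NormalCoordinates M')
    {H : FormalMap (Fin (n + d)) (Fin (n + d))} (hH : H.MapsInto M M') (k : Fin d) :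
    x.leafHom ((express x x' H).toSeries (Sum.inr k)) = leafMapHom x x' H (x'.segreQ k) := by
  -- The parametrization (z, Q(z,χ,0), χ, 0) of the points of M with τ = 0.
  let φ : MvPowerSeries ((Fin n ⊕ Fin d) ⊕ (Fin n ⊕ Fin d)) ℂ →ₐ[ℂ]
      MvPowerSeries (Fin n ⊕ Fin n) ℂ :=
    substHom (Sum.elim (Sum.elim (fun i => X (Sum.inl i)) x.segreQ)
      (Sum.elim (fun i => X (Sum.inr i)) fun _ => 0))
      (by rintro ((i | i) | (i | i)) <;> simp [constantCoeff_segreQ])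
  have h1 : φ.comp toAmbient = segreHom := by
    refine algHom_ext_of_constantCoeff ?_ ?_
    · rintro (i | i | i) <;> simp [φ]
    · rintro (i | i | i) <;> simp [φ]
  have h2 : φ.comp (inlHom _) = x.leafHom := by
    refine algHom_ext_of_constantCoeff ?_ ?_
    · rintro (i | i) <;> simp [φ, constantCoeff_segreQ]
    · rintro (i | i) <;> simp [φ]
  have h3 : φ.comp (inrHom _) = (inrHom _).comp axisHom := by
    refine algHom_ext_of_constantCoeff ?_ ?_
    · rintro (i | i) <;> simp [φ]
    · rintro (i | i) <;> simp [φ]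
  have h4 : (φ.comp (express x x' H).doubleHom).comp toAmbient =
      (leafMapHom x x' H).comp segreHom := by
    have hX : ∀ i, ((φ.comp (express x x' H).doubleHom).comp toAmbient) (X i) =
        ((leafMapHom x x' H).comp segreHom) (X i) := by
      rintro (i | i | i)
      · simp only [AlgHom.comp_apply, toAmbient_X_inl, segreHom_X_inl, FormalMap.doubleHom_X,
          FormalMap.double_inl, leafMapHom, substHom_X]
        exact AlgHom.congr_fun h2 _
      · simp only [AlgHom.comp_apply, toAmbient_X_inr, segreHom_X_inr_inl, FormalMap.doubleHom_X,
          FormalMap.double_inr, leafMapHom, substHom_X]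
        refine (AlgHom.congr_fun h3 _).trans ?_
        rw [AlgHom.comp_apply, FormalMap.conj, ← conjSeries_axisHom, ← segreSeries_eq]
        rfl
      -- Here Ḡ(χ,0) = 0 is what puts τ' = 0 in the argument of Q'.
      · simp only [AlgHom.comp_apply, toAmbient_X_inr, segreHom_X_inr_inr, FormalMap.doubleHom_X,
          FormalMap.double_inr, map_zero]
        refine (AlgHom.congr_fun h3 _).trans ?_
        rw [AlgHom.comp_apply, FormalMap.conj, ← conjSeries_axisHom, axisHom_express_inr x x' hH,
          conjSeries, map_zero, map_zero]
    refine algHom_ext_of_constantCoeff (fun i => ?_) hX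
    rw [hX, AlgHom.comp_apply, leafMapHom, constantCoeff_substHom, segreHom, constantCoeff_substHom,
      constantCoeff_X]
  have h5 := map_express_eq x x' hH φ (fun k => by
    rw [← AlgHom.comp_apply φ toAmbient, h1]
    simp [φ, segreQ]) k
  rw [← AlgHom.comp_apply φ (inlHom _), h2] at h5
  rw [h5]
  exact AlgHom.congr_fun h4 (x'.Q k)

end NormalCoordinates

/-! ### The essential ideal and CR transversality -/

namespace NormalCoordinates

open MvPowerSeries

variable {n d : ℕ} {M M' : FormalGenericSubmanifold (n + d) d}

/-- This form of setting τ = 0 has an explicit coefficient formula. -/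
theorem segreHom_eq_killCompl :
    (segreHom : MvPowerSeries (Fin n ⊕ (Fin n ⊕ Fin d)) ℂ →ₐ[ℂ] _) =
      killCompl (Function.Embedding.sumMap (.refl (Fin n)) .inl) := by
  refine algHom_ext_of_constantCoeff ?_ ?_
  · rintro (i | i | i) <;> simp
  · rintro (i | i | i)
    · rw [segreHom_X_inl]
      exact (killCompl_X (e := Function.Embedding.sumMap (.refl (Fin n))
        (.inl : Fin n ↪ Fin n ⊕ Fin d)) (Sum.inl i)).symm
    · rw [segreHom_X_inr_inl]
      exact (killCompl_X (e := Function.Embedding.sumMap (.refl (Fin n))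
        (.inl : Fin n ↪ Fin n ⊕ Fin d)) (Sum.inr i)).symm
    · rw [segreHom_X_inr_inr, killCompl_X_eq_zero]
      rintro ⟨j | j, hj⟩ <;> simp at hj

theorem qCoeff_eq (x : NormalCoordinates M) (j : Fin d) (α : Fin n →₀ ℕ) :
    x.qCoeff j α = coeff α (sumToIter (x.segreQ j)) := by
  ext β
  rw [coeff_coeff_sumToIter, segreQ, segreHom_eq_killCompl, coeff_killCompl]
  change coeff (Finsupp.sumElim α (Finsupp.sumElim β 0)) (x.Q j) = _
  congr 2
  ext t
  let e : Fin n ⊕ Fin n ↪ Fin n ⊕ (Fin n ⊕ Fin d) :=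
    Function.Embedding.sumMap (.refl (Fin n)) .inl
  change _ = Finsupp.embDomain e (Finsupp.sumElim α β) t
  rcases t with i | i | i
  · exact (Finsupp.embDomain_apply_self e (Finsupp.sumElim α β) (Sum.inl i)).symm
  · exact (Finsupp.embDomain_apply_self e (Finsupp.sumElim α β) (Sum.inr i)).symm
  · rw [Finsupp.embDomain_of_notMem_range]
    · rfl
    · rintro ⟨j | j, hj⟩ <;> simp [e] at hj

/-- The essential ideal is the smallest ideal of power series in `χ` over which `Q(z, χ, 0)`
vanishes. -/
theorem essentialIdeal_le_iff (x : NormalCoordinates M) (K : Ideal (MvPowerSeries (Fin n) ℂ)) :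
    x.essentialIdeal ≤ K ↔ ∀ k, x.segreQ k ∈ K.map (inrHom (Fin n)) := by
  rw [essentialIdeal, Ideal.span_le]
  constructor
  · intro h k
    rw [mem_map_inrHom_iff]
    intro a
    rw [← qCoeff_eq]
    exact h ⟨k, a, rfl⟩
  · rintro h _ ⟨j, α, rfl⟩
    rw [qCoeff_eq]
    exact (mem_map_inrHom_iff _ _).mp (h j) α

/-- These constants are the coefficients of Q(z,0,0), which vanishes by normality. -/
theorem constantCoeff_qCoeff (x : NormalCoordinates M) (j : Fin d) (α : Fin n →₀ ℕ) :
    constantCoeff (x.qCoeff j α) = 0 := by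
  have h : (originHom : MvPowerSeries (Fin n ⊕ (Fin n ⊕ Fin d)) ℂ →ₐ[ℂ] _) =
      killCompl .inl := by
    refine algHom_ext_of_constantCoeff ?_ ?_
    · rintro (i | i) <;> simp
    · rintro (i | i)
      · rw [originHom_X_inl]
        exact (killCompl_X (e := (.inl : Fin n ↪ Fin n ⊕ (Fin n ⊕ Fin d))) i).symm
      · rw [originHom_X_inr, killCompl_X_eq_zero]
        simp
  have h1 := congrArg (coeff α) (x.originHom_Q j)
  rw [h, coeff_killCompl, map_zero] at h1
  rw [← h1]
  change coeff (Finsupp.sumElim α (Finsupp.sumElim 0 0)) (x.Q j) = _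
  congr 2
  ext t
  let e : Fin n ↪ Fin n ⊕ (Fin n ⊕ Fin d) := .inl
  change _ = Finsupp.embDomain e α t
  rcases t with i | i
  · exact (Finsupp.embDomain_apply_self e α i).symm
  · rw [Finsupp.embDomain_of_notMem_range _ _ _ (by simp [e])]
    simp

theorem essentialIdeal_le_span_X (x : NormalCoordinates M) :
    x.essentialIdeal ≤ Ideal.span (Set.range X) := by
  rw [essentialIdeal, Ideal.span_le]
  rintro _ ⟨j, α, rfl⟩
  exact (mem_span_range_X_iff _).mpr (x.constantCoeff_qCoeff j α)

theorem coeff_single_inl_Q (x : NormalCoordinates M) (k : Fin d) (i : Fin n) :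
    coeff (Finsupp.single (Sum.inl i) 1) (x.Q k) = 0 := by
  classical
  have h := coeff_single_algHom (φ := originHom) (by rintro (i | i) <;> simp) (x.Q k) i
  rw [originHom_Q, map_zero] at h
  simpa [coeff_X, Finsupp.single_left_inj, Fintype.sum_sum_type] using h.symm

theorem coeff_single_graph (x : NormalCoordinates M) (k : Fin d) (t : Fin n ⊕ Fin d) :
    coeff (Finsupp.single (Sum.inl t) 1) (x.graph k) = if t = Sum.inr k then 1 else 0 := by
  classical
  rw [graph, map_sub, coeff_single_algHom (by rintro (i | i) <;> simp)]
  rcases t with i | l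
  · simp [coeff_X, Finsupp.single_left_inj, Fintype.sum_sum_type, coeff_single_inl_Q]
  · simp [coeff_X, Finsupp.single_left_inj, Fintype.sum_sum_type]

theorem constantCoeff_graph (x : NormalCoordinates M) (k : Fin d) :
    constantCoeff (x.graph k) = 0 := by
  rw [graph, map_sub, constantCoeff_X, toAmbient, constantCoeff_substHom, x.constantCoeff_Q,
    sub_zero]

theorem coeff_single_inl_inlHom {α β : Type} [Fintype α] (f : MvPowerSeries α ℂ) (a : α) :
    coeff (Finsupp.single (Sum.inl a : α ⊕ β) 1) (inlHom β f) = coeff (Finsupp.single a 1) f := by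
  classical
  rw [coeff_single_algHom (by simp)]
  simp [coeff_X, Finsupp.single_left_inj]

theorem coeff_single_inl_inrHom {α β : Type} [Fintype β] (f : MvPowerSeries β ℂ) (a : α) :
    coeff (Finsupp.single (Sum.inl a : α ⊕ β) 1) (inrHom α f) = 0 := by
  classical
  rw [coeff_single_algHom (by simp)]
  simp [coeff_X, Finsupp.single_left_inj]

theorem _root_.FormalMap.differential_apply {σ τ : Type} [Fintype σ] (H : FormalMap σ τ)
    (v : σ → ℂ) (k : τ) :
    H.differential v k = ∑ i, coeff (Finsupp.single i 1) (H.toSeries k) * v i := rfl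

theorem coord_differential_inv_differential (x : NormalCoordinates M) (v : Fin (n + d) → ℂ) :
    x.coord.differential (x.inv.differential v) = v := by
  rw [← LinearMap.comp_apply, ← FormalMap.differential_comp, x.coord_comp_inv,
    FormalMap.differential_id, LinearMap.id_apply]

theorem inv_differential_coord_differential (x : NormalCoordinates M) (v : Fin n ⊕ Fin d → ℂ) :
    x.inv.differential (x.coord.differential v) = v := by
  rw [← LinearMap.comp_apply, ← FormalMap.differential_comp, x.inv_comp_coord,
    FormalMap.differential_id, LinearMap.id_apply]

/-- In normal coordinates, `T^{1,0}_0 M` is given by `w = 0`. -/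
theorem inv_differential_inr_eq_zero (x : NormalCoordinates M) {v : Fin (n + d) → ℂ}
    (hv : v ∈ M.holTangent) (k : Fin d) : x.inv.differential v (Sum.inr k) = 0 := by
  classical
  obtain ⟨a, ha, h⟩ := x.exists_doubleHom_rho
  let u := x.inv.differential v
  let a₀ : Matrix (Fin d) (Fin d) ℂ := a.map constantCoeff
  have ha₀ : IsUnit a₀ := ha.map (RingHom.mapMatrix (constantCoeff (R := ℂ)))
  -- Comparison of the terms linear in (z,w) in the defining identity; the part of w − Q linear in
  -- (z,w) is w alone, so only a(0) enters.
  have hlin : ∀ j t, ∑ m, coeff (Finsupp.single (Sum.inl m) 1) (M.rho j) *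
      coeff (Finsupp.single t 1) (x.coord.toSeries m) =
        ∑ k, a₀ j k * if t = Sum.inr k then 1 else 0 := by
    intro j t
    have h1 := congrArg (coeff (Finsupp.single (Sum.inl t) 1)) (h j)
    rw [coeff_single_algHom (by intro i; rw [FormalMap.doubleHom_X, FormalMap.constantCoeff_double]),
      Fintype.sum_sum_type, map_sum] at h1
    simp only [FormalMap.doubleHom_X, FormalMap.double_inl, FormalMap.double_inr,
      coeff_single_inl_inlHom, coeff_single_inl_inrHom, mul_zero, Finset.sum_const_zero,
      add_zero, coeff_single_mul _ _ _ (x.constantCoeff_graph _), coeff_single_graph] at h1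
    exact h1
  have hzero : a₀.mulVec (fun k => u (Sum.inr k)) = 0 := by
    funext j
    have h2 : ∑ m, coeff (Finsupp.single (Sum.inl m) 1) (M.rho j) * v m = 0 :=
      congrFun (LinearMap.mem_ker.mp hv) j
    have h3 : ∀ m, v m = ∑ t, coeff (Finsupp.single t 1) (x.coord.toSeries m) * u t := by
      intro m
      rw [← FormalMap.differential_apply, x.coord_differential_inv_differential]
    simp only [h3, Finset.mul_sum, ← mul_assoc] at h2
    rw [Finset.sum_comm] at h2
    simp only [← Finset.sum_mul, hlin] at h2
    rw [Fintype.sum_sum_type] at h2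
    simpa [Matrix.mulVec, dotProduct] using h2
  have hinj := Matrix.mulVec_injective_of_isUnit ha₀
  have := hinj (hzero.trans (Matrix.mulVec_zero _).symm)
  exact congrFun this k

/-- CR transversality in normal coordinates: the derivative of `G` with respect to `w` is
invertible at the origin. -/
theorem isUnit_of_isCRTransversal (x : NormalCoordinates M) (x' : NormalCoordinates M')
    {H : FormalMap (Fin (n + d)) (Fin (n + d))} (hH : H.MapsInto M M')
    (hT : H.IsCRTransversal M') :
    IsUnit (Matrix.of fun k l : Fin d => coeff (Finsupp.single (Sum.inr l) 1)
      ((express x x' H).toSeries (Sum.inr k))) := by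
  classical
  rw [← Matrix.mulVec_surjective_iff_isUnit]
  intro e
  -- A purely transversal vector is split by CR transversality; the part tangent to M' has no
  -- w'-component, so the image of dH must produce e.
  have htop : x'.coord.differential (Sum.elim 0 e) ∈
      M'.holTangent ⊔ LinearMap.range H.differential := by
    rw [hT]; trivial
  obtain ⟨t, ht, _, ⟨u, rfl⟩, htu⟩ := Submodule.mem_sup.mp htop
  refine ⟨fun l => x.inv.differential u (Sum.inr l), ?_⟩
  funext k
  have h1 := congrFun (congrArg x'.inv.differential htu) (Sum.inr k)
  rw [x'.inv_differential_coord_differential, map_add, Pi.add_apply,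
    x'.inv_differential_inr_eq_zero ht, zero_add, ← x.coord_differential_inv_differential u,
    ← LinearMap.comp_apply H.differential, ← FormalMap.differential_comp,
    ← LinearMap.comp_apply x'.inv.differential, ← FormalMap.differential_comp] at h1
  change (express x x' H).differential _ _ = e k at h1
  rw [FormalMap.differential_apply, Fintype.sum_sum_type] at h1
  -- Since G(z,0) = 0, only the w-derivatives of G contribute.
  have h2 : ∀ i : Fin n, coeff (Finsupp.single (Sum.inl i) 1)
      ((express x x' H).toSeries (Sum.inr k)) = 0 := by
    intro i
    have h := coeff_single_algHom (φ := axisHom) (by rintro (i | i) <;> simp)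
      ((express x x' H).toSeries (Sum.inr k)) i
    rw [axisHom_express_inr x x' hH, map_zero] at h
    simpa [coeff_X, Finsupp.single_left_inj, Fintype.sum_sum_type] using h.symm
  simp only [h2, zero_mul, Finset.sum_const_zero, zero_add] at h1
  exact h1

/-- `G(z, w) = B(z, w) w` with an invertible matrix `B`. -/
theorem exists_isUnit_express_inr (x : NormalCoordinates M) (x' : NormalCoordinates M')
    {H : FormalMap (Fin (n + d)) (Fin (n + d))} (hH : H.MapsInto M M')
    (hT : H.IsCRTransversal M') :
    ∃ B : Matrix (Fin d) (Fin d) (MvPowerSeries (Fin n ⊕ Fin d) ℂ), IsUnit B ∧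
      ∀ k, (express x x' H).toSeries (Sum.inr k) = ∑ l, B k l * X (Sum.inr l) := by
  classical
  have hmem : ∀ k, (express x x' H).toSeries (Sum.inr k) ∈ Ideal.span (Set.range
      fun l : Fin d => (X (Sum.inr l) : MvPowerSeries (Fin n ⊕ Fin d) ℂ)) := by
    intro k
    have h := algHom_sub_mem_of_mem_maximalIdeal (φ := AlgHom.id ℂ _)
      (ψ := (inlHom (Fin d)).comp axisHom) (Ideal.span (Set.range
      fun l : Fin d => (X (Sum.inr l) : MvPowerSeries (Fin n ⊕ Fin d) ℂ)))
      (fun i => (mem_maximalIdeal_iff _).mpr (constantCoeff_X i)) (by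
        rintro (i | i)
        · simp
        · simpa using Ideal.subset_span (Set.mem_range_self i)) ((express x x' H).toSeries (Sum.inr k))
    rwa [AlgHom.comp_apply, axisHom_express_inr x x' hH, map_zero, sub_zero] at h
  choose B hB using fun k => Ideal.mem_span_range_iff_exists_fun.mp (hmem k)
  refine ⟨Matrix.of B, ?_, fun k => (hB k).symm⟩
  have hunit := isUnit_of_isCRTransversal x x' hH hT
  -- The w-derivative of G = Bw at the origin is B(0), and a matrix of power series is invertible as
  -- soon as its constant term is.
  have h0 : (Matrix.of fun k l : Fin d => coeff (Finsupp.single (Sum.inr l) 1)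
      ((express x x' H).toSeries (Sum.inr k))) =
        (RingHom.mapMatrix (constantCoeff (R := ℂ))) (Matrix.of B) := by
    ext k l
    rw [Matrix.of_apply, ← hB k, map_sum]
    simp [coeff_single_mul _ _ _ (constantCoeff_X _), coeff_X, Finsupp.single_left_inj]
  rw [h0, Matrix.isUnit_iff_isUnit_det, ← RingHom.map_det] at hunit
  rw [Matrix.isUnit_iff_isUnit_det, isUnit_iff_constantCoeff]
  exact hunit

/-- The ideals generated by `Q(z, χ, 0)` and by `Q'(F(z, Q), F̄(χ, 0), 0)` coincide. -/
theorem span_segreQ_eq (x : NormalCoordinates M) (x' : NormalCoordinates M')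
    {H : FormalMap (Fin (n + d)) (Fin (n + d))} (hH : H.MapsInto M M')
    (hT : H.IsCRTransversal M') :
    Ideal.span (Set.range x.segreQ) =
      Ideal.span (Set.range fun k => leafMapHom x x' H (x'.segreQ k)) := by
  obtain ⟨B, hunit, hB⟩ := exists_isUnit_express_inr x x' hH hT
  have hG : ∀ k, leafMapHom x x' H (x'.segreQ k) = ∑ l, x.leafHom (B k l) * x.segreQ l := by
    intro k
    rw [← leafHom_express_inr x x' hH, hB, map_sum]
    simp
  apply le_antisymm
  · rw [Ideal.span_le]
    rintro _ ⟨k, rfl⟩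
    obtain ⟨A, hA⟩ := (hunit.map (RingHom.mapMatrix x.leafHom.toRingHom)).exists_left_inv
    have : x.segreQ k = ∑ l, A k l * leafMapHom x x' H (x'.segreQ l) := by
      have hG' : ∀ l, leafMapHom x x' H (x'.segreQ l) =
          ∑ m, (RingHom.mapMatrix x.leafHom.toRingHom B) l m * x.segreQ m := hG
      simp only [hG', Finset.mul_sum, ← mul_assoc]
      rw [Finset.sum_comm]
      simp only [← Finset.sum_mul, ← Matrix.mul_apply, hA, Matrix.one_apply]
      simp
    rw [this]
    exact Ideal.sum_mem _ fun l _ => Ideal.mul_mem_left _ _ (Ideal.subset_span ⟨l, rfl⟩)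
  · rw [Ideal.span_le]
    rintro _ ⟨k, rfl⟩
    rw [SetLike.mem_coe]
    beta_reduce
    rw [hG]
    exact Ideal.sum_mem _ fun l _ => Ideal.mul_mem_left _ _ (Ideal.subset_span ⟨l, rfl⟩)

end NormalCoordinates

/-! ### Invariance of codimension under conjugation -/

namespace MvPowerSeries

/-- The ring automorphism conjugating the coefficients. -/
noncomputable def conjEquiv (σ : Type) : MvPowerSeries σ ℂ ≃+* MvPowerSeries σ ℂ :=
  RingEquiv.ofRingHom (map (starRingEnd ℂ)) (map (starRingEnd ℂ))
    (by ext f e; simp) (by ext f e; simp)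

theorem conjEquiv_apply {σ : Type} (f : MvPowerSeries σ ℂ) : conjEquiv σ f = conjSeries f := rfl

/-- Conjugation is only semilinear over ℂ, so dimensions are transported along a pair of ring
isomorphisms, one of them on the scalars. This links m_H, defined by F(z,0), with the map F̄(χ,0)
relating the essential ideals. -/
theorem finite_and_finrank_quotient_conjSeries {σ ι : Type} (f : ι → MvPowerSeries σ ℂ) :
    (Module.Finite ℂ (MvPowerSeries σ ℂ ⧸ Ideal.span (Set.range f)) ↔
      Module.Finite ℂ (MvPowerSeries σ ℂ ⧸ Ideal.span (Set.range fun i => conjSeries (f i)))) ∧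
    Module.finrank ℂ (MvPowerSeries σ ℂ ⧸ Ideal.span (Set.range f)) =
      Module.finrank ℂ (MvPowerSeries σ ℂ ⧸ Ideal.span (Set.range fun i => conjSeries (f i))) := by
  have hmap : Ideal.span (Set.range fun i => conjSeries (f i)) =
      (Ideal.span (Set.range f)).map (conjEquiv σ : MvPowerSeries σ ℂ →+* MvPowerSeries σ ℂ) := by
    rw [Ideal.map_span, ← Set.range_comp]
    rfl
  let e := Ideal.quotientEquiv _ _ (conjEquiv σ) hmap
  have he : (algebraMap ℂ (MvPowerSeries σ ℂ ⧸ Ideal.span (Set.range fun i =>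
      conjSeries (f i)))).comp (starRingAut (R := ℂ) : ℂ →+* ℂ) =
      (e : _ →+* _).comp (algebraMap ℂ (MvPowerSeries σ ℂ ⧸ Ideal.span (Set.range f))) := by
    ext c : 1
    change Ideal.Quotient.mk _ (C (starRingEnd ℂ c)) = Ideal.Quotient.mk _ (conjEquiv σ (C c))
    rw [conjEquiv_apply, conjSeries, map_C]
  have he' : (algebraMap ℂ (MvPowerSeries σ ℂ ⧸ Ideal.span (Set.range f))).comp
      ((starRingAut (R := ℂ)).symm : ℂ →+* ℂ) =
      (e.symm : _ →+* _).comp (algebraMap ℂ (MvPowerSeries σ ℂ ⧸ Ideal.span (Set.range fun i =>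
      conjSeries (f i)))) := by
    ext c : 1
    have h := RingHom.congr_fun he ((starRingAut (R := ℂ)).symm c)
    simp only [RingHom.comp_apply, RingHom.coe_coe, RingEquiv.apply_symm_apply] at h ⊢
    rw [h, RingEquiv.symm_apply_apply]
  refine ⟨⟨fun h => Module.Finite.of_equiv_equiv _ e he, fun h =>
    Module.Finite.of_equiv_equiv _ e.symm he'⟩, Algebra.finrank_eq_of_equiv_equiv (starRingAut (R := ℂ)) e he⟩

end MvPowerSeries

/-! ### Comparison of the essential ideals -/

namespace NormalCoordinates

open MvPowerSeries

variable {n d : ℕ} {M M' : FormalGenericSubmanifold (n + d) d}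

/-- The homomorphism `χ' ↦ F̄(χ, 0)`. -/
noncomputable def conjSegreHom (x : NormalCoordinates M) (x' : NormalCoordinates M')
    (H : FormalMap (Fin (n + d)) (Fin (n + d))) :
    MvPowerSeries (Fin n) ℂ →ₐ[ℂ] MvPowerSeries (Fin n) ℂ :=
  substHom (fun i => conjSeries (segreSeries x x' H i))
    (by simp [constantCoeff_conjSeries, constantCoeff_segreSeries])

theorem conjSegreHom_X (x : NormalCoordinates M) (x' : NormalCoordinates M')
    (H : FormalMap (Fin (n + d)) (Fin (n + d))) (i : Fin n) :
    conjSegreHom x x' H (X i) = conjSeries (segreSeries x x' H i) :=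
  substHom_X _ _ i

theorem constantCoeff_conjSegreHom_X (x : NormalCoordinates M) (x' : NormalCoordinates M')
    (H : FormalMap (Fin (n + d)) (Fin (n + d))) (i : Fin n) :
    constantCoeff (conjSegreHom x x' H (X i)) = 0 := by
  rw [conjSegreHom, constantCoeff_substHom, constantCoeff_X]

/-- The series Q'(z',χ',0) has its χ'-coefficients in I_{M'}; substituting F̄(χ,0) for χ' puts the
common ideal of `span_segreQ_eq` inside the extension, whatever is substituted for z'. No finiteness
is needed. -/
theorem essentialIdeal_le_map (x : NormalCoordinates M) (x' : NormalCoordinates M')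
    {H : FormalMap (Fin (n + d)) (Fin (n + d))} (hH : H.MapsInto M M')
    (hT : H.IsCRTransversal M') :
    x.essentialIdeal ≤ x'.essentialIdeal.map (conjSegreHom x x' H) := by
  rw [essentialIdeal_le_iff]
  intro k
  have hcomp : (leafMapHom x x' H).comp (inrHom (Fin n)) =
      (inrHom (Fin n)).comp (conjSegreHom x x' H) := by
    refine algHom_ext_of_constantCoeff (fun i => ?_) (fun i => ?_)
    · rw [AlgHom.comp_apply, inrHom_X, leafMapHom, constantCoeff_substHom, constantCoeff_X]
    · simp [leafMapHom, conjSegreHom]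
  have hmap : (x'.essentialIdeal.map (conjSegreHom x x' H)).map (inrHom (Fin n)) =
      (x'.essentialIdeal.map (inrHom (Fin n))).map (leafMapHom x x' H) := by
    rw [Ideal.map_mapₐ, Ideal.map_mapₐ, hcomp]
  have hle : Ideal.span (Set.range x.segreQ) ≤
      (x'.essentialIdeal.map (conjSegreHom x x' H)).map (inrHom (Fin n)) := by
    rw [span_segreQ_eq x x' hH hT, Ideal.span_le, hmap]
    rintro _ ⟨l, rfl⟩
    exact Ideal.mem_map_of_mem _ ((x'.essentialIdeal_le_iff _).mp le_rfl l)
  exact hle (Ideal.subset_span ⟨k, rfl⟩)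

/-- The homomorphism `z' ↦ F(z, 0)`, `χ ↦ χ`. -/
noncomputable def segreProdHom (x : NormalCoordinates M) (x' : NormalCoordinates M')
    (H : FormalMap (Fin (n + d)) (Fin (n + d))) :
    MvPowerSeries (Fin n ⊕ Fin n) ℂ →ₐ[ℂ] MvPowerSeries (Fin n ⊕ Fin n) ℂ :=
  substHom (Sum.elim (fun i => inlHom _ (segreSeries x x' H i)) fun i => X (Sum.inr i))
    (by rintro (i | i) <;> simp [inlHom, constantCoeff_substHom, constantCoeff_segreSeries])

/-- Dividing by the images of the variables sets χ = 0 and leaves a quotient of ℂ⟦z⟧/I(F(z,0)). -/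
theorem finite_quotient_segreProdHom (x : NormalCoordinates M) (x' : NormalCoordinates M')
    {H : FormalMap (Fin (n + d)) (Fin (n + d))} (hF : IsSegreFinite x x' H) :
    Module.Finite ℂ (MvPowerSeries (Fin n ⊕ Fin n) ℂ ⧸
      Ideal.span (Set.range fun i => segreProdHom x x' H (X i))) := by
  let J := Ideal.span (Set.range fun i => segreProdHom x x' H (X i))
  let φ : MvPowerSeries (Fin n) ℂ →ₐ[ℂ] MvPowerSeries (Fin n ⊕ Fin n) ℂ ⧸ J :=
    (Ideal.Quotient.mkₐ ℂ J).comp (inlHom (Fin n))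
  have hker : segreIdeal x x' H ≤ RingHom.ker φ := by
    rw [segreIdeal, Ideal.span_le]
    rintro _ ⟨i, rfl⟩
    refine Ideal.Quotient.eq_zero_iff_mem.mpr (Ideal.subset_span ⟨Sum.inl i, ?_⟩)
    simp [segreProdHom]
  have hsurj : Function.Surjective φ := by
    intro g
    obtain ⟨g, rfl⟩ := Ideal.Quotient.mk_surjective g
    let ρ : MvPowerSeries (Fin n ⊕ Fin n) ℂ →ₐ[ℂ] MvPowerSeries (Fin n) ℂ :=
      substHom (Sum.elim X fun _ => 0) (by rintro (i | i) <;> simp)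
    refine ⟨ρ g, Ideal.Quotient.eq.mpr ?_⟩
    refine algHom_sub_mem_of_mem_maximalIdeal (φ := (inlHom (Fin n)).comp ρ)
      (ψ := AlgHom.id ℂ _) J ?_ ?_ g
    · rintro (i | i) <;> rw [mem_maximalIdeal_iff] <;> simp [ρ]
    · rintro (i | i)
      · simp [ρ]
      · have : X (Sum.inr i) ∈ J := Ideal.subset_span ⟨Sum.inr i, by simp [segreProdHom]⟩
        simpa [ρ] using this
  have : Module.Finite ℂ (MvPowerSeries (Fin n) ℂ ⧸ segreIdeal x x' H) := hF
  refine Module.Finite.of_surjective (Ideal.Quotient.liftₐ (segreIdeal x x' H) φ hker).toLinearMap ?_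
  intro g
  obtain ⟨f, rfl⟩ := hsurj g
  exact ⟨Ideal.Quotient.mk _ f, rfl⟩

/-- Modulo I_M one may put w = 0 in F; faithful flatness of z' ↦ F(z,0), with χ as a parameter, then
removes F from the first argument of Q'. -/
theorem map_le_essentialIdeal (x : NormalCoordinates M) (x' : NormalCoordinates M')
    {H : FormalMap (Fin (n + d)) (Fin (n + d))} (hH : H.MapsInto M M')
    (hT : H.IsCRTransversal M') (hF : IsSegreFinite x x' H) :
    x'.essentialIdeal.map (conjSegreHom x x' H) ≤ x.essentialIdeal := by
  let K := x.essentialIdeal.map (inrHom (Fin n))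
  -- The substitution χ' ↦ F̄(χ,0) with z' kept free; following it by z' ↦ F(z,0) gives `leafMapHom`
  -- modulo K.
  let θ : MvPowerSeries (Fin n ⊕ Fin n) ℂ →ₐ[ℂ] MvPowerSeries (Fin n ⊕ Fin n) ℂ :=
    substHom (Sum.elim (fun i => X (Sum.inl i))
      fun i => inrHom _ (conjSeries (segreSeries x x' H i)))
      (by rintro (i | i) <;> simp [constantCoeff_inrHom, constantCoeff_conjSeries,
            constantCoeff_segreSeries])
  have hq : ∀ k, x.segreQ k ∈ K := (x.essentialIdeal_le_iff _).mp le_rfl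
  have h1 : ∀ k, leafMapHom x x' H (x'.segreQ k) ∈ K := by
    intro k
    have : Ideal.span (Set.range x.segreQ) ≤ K := by
      rw [Ideal.span_le]
      rintro _ ⟨k, rfl⟩
      exact hq k
    rw [span_segreQ_eq x x' hH hT] at this
    exact this (Ideal.subset_span ⟨k, rfl⟩)
  have h2 : ∀ f, leafMapHom x x' H f - ((segreProdHom x x' H).comp θ) f ∈ K := by
    refine algHom_sub_mem_of_mem_maximalIdeal K ?_ ?_
    · intro i
      rw [mem_maximalIdeal_iff, leafMapHom, constantCoeff_substHom, constantCoeff_X]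
    · rintro (i | i)
      · have h3 : ∀ f, x.leafHom f - ((inlHom (Fin n)).comp axisHom) f ∈ K := by
          refine algHom_sub_mem_of_mem_maximalIdeal K ?_ ?_
          · intro i
            rw [mem_maximalIdeal_iff, constantCoeff_leafHom, constantCoeff_X]
          · rintro (i | i)
            · simp
            · simpa using hq i
        simpa [leafMapHom, θ, segreProdHom, segreSeries_eq] using
          h3 ((express x x' H).toSeries (Sum.inl i))
      · have h4 : (segreProdHom x x' H).comp (inrHom (Fin n)) = inrHom (Fin n) := by
          refine algHom_ext_of_constantCoeff (fun i => ?_) fun i => ?_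
          · simp [segreProdHom]
          · simp [segreProdHom]
        have h5 := AlgHom.congr_fun h4 (conjSeries (segreSeries x x' H i))
        rw [AlgHom.comp_apply] at h5
        simp [leafMapHom, θ, h5]
  -- K is generated by series in χ alone, which `segreProdHom` fixes.
  have h6 : K.map (segreProdHom x x' H) = K := by
    have h4 : (segreProdHom x x' H).comp (inrHom (Fin n)) = inrHom (Fin n) := by
      refine algHom_ext_of_constantCoeff (fun i => ?_) fun i => ?_
      · simp [segreProdHom]
      · simp [segreProdHom]
    rw [Ideal.map_mapₐ, h4]
  have h7 : ∀ k, θ (x'.segreQ k) ∈ K := by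
    intro k
    have h8 : segreProdHom x x' H (θ (x'.segreQ k)) ∈ K := by
      have := sub_mem (h1 k) (h2 (x'.segreQ k))
      rwa [sub_sub_cancel] at this
    -- K is the contraction of its own extension, so membership descends.
    rw [← comap_map_of_finite_quotient (segreProdHom x x' H) rfl
      (fun i => by rw [segreProdHom, constantCoeff_substHom, constantCoeff_X])
      (finite_quotient_segreProdHom x x' hF) K, Ideal.mem_comap, h6]
    exact h8
  -- As θ fixes z', it acts on each z'-coefficient separately.
  have h9 : ∀ f a, coeff a (sumToIter (θ f)) = conjSegreHom x x' H (coeff a (sumToIter f)) := by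
    have h10 : sumToIter.comp θ = (mapAlgHom (conjSegreHom x x' H)).comp sumToIter := by
      refine algHom_ext_of_mem_maximalIdeal ?_ ?_
      · rintro (i | i) <;> rw [IsLocalRing.mem_maximalIdeal, mem_nonunits_iff,
          isUnit_iff_constantCoeff, isUnit_iff_constantCoeff]
        · simp [θ, sumToIter_X_inl]
        · simp [θ, sumToIter_inrHom, constantCoeff_conjSeries, constantCoeff_segreSeries]
      · rintro (i | i)
        · simp [θ, sumToIter_X_inl, mapAlgHom_apply]
        · simp [θ, sumToIter_inrHom, sumToIter_X_inr, mapAlgHom_apply, conjSegreHom_X]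
    intro f a
    have h11 := congrArg (coeff a) (AlgHom.congr_fun h10 f)
    rwa [AlgHom.comp_apply, AlgHom.comp_apply, mapAlgHom_apply, coeff_map] at h11
  rw [Ideal.map_le_iff_le_comap, essentialIdeal, Ideal.span_le]
  rintro _ ⟨j, α, rfl⟩
  change conjSegreHom x x' H (x'.qCoeff j α) ∈ x.essentialIdeal
  rw [qCoeff_eq, ← h9]
  exact (mem_map_inrHom_iff _ _).mp (h7 j) α

theorem essentialIdeal_eq_map (x : NormalCoordinates M) (x' : NormalCoordinates M')
    {H : FormalMap (Fin (n + d)) (Fin (n + d))} (hH : H.MapsInto M M')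
    (hT : H.IsCRTransversal M') (hF : IsSegreFinite x x' H) :
    x.essentialIdeal = x'.essentialIdeal.map (conjSegreHom x x' H) :=
  le_antisymm (essentialIdeal_le_map x x' hH hT) (map_le_essentialIdeal x x' hH hT hF)

/-- I_M is contained in the extension of I_{M'}, hence in the ideal generated by the components of
F̄(χ,0), which inherits finite codimension. -/
theorem isSegreFinite_of_isEssentiallyFinite (x : NormalCoordinates M)
    (x' : NormalCoordinates M') {H : FormalMap (Fin (n + d)) (Fin (n + d))}
    (hH : H.MapsInto M M') (hT : H.IsCRTransversal M') (hM : x.IsEssentiallyFinite) :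
    IsSegreFinite x x' H := by
  rw [IsSegreFinite, segreIdeal, (finite_and_finrank_quotient_conjSeries _).1]
  have hle : x.essentialIdeal ≤
      Ideal.span (Set.range fun i => conjSeries (segreSeries x x' H i)) := by
    refine (essentialIdeal_le_map x x' hH hT).trans
      ((Ideal.map_mono x'.essentialIdeal_le_span_X).trans ?_)
    rw [Ideal.map_span, ← Set.range_comp]
    refine Ideal.span_mono ?_
    rintro _ ⟨i, rfl⟩
    exact ⟨i, (conjSegreHom_X x x' H i).symm⟩
  have : Module.Finite ℂ (MvPowerSeries (Fin n) ℂ ⧸ x.essentialIdeal) := hM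
  exact Module.Finite.of_surjective (Ideal.Quotient.factorₐ ℂ hle).toLinearMap
    (Ideal.Quotient.factor_surjective hle)

theorem essentiallyFinite_iff_and_essentialType_eq (x : NormalCoordinates M)
    (x' : NormalCoordinates M') {H : FormalMap (Fin (n + d)) (Fin (n + d))}
    (hH : H.MapsInto M M') (hT : H.IsCRTransversal M') (hF : IsSegreFinite x x' H) :
    (x.IsEssentiallyFinite ↔ x'.IsEssentiallyFinite) ∧
      x.essentialType = segreMultiplicity x x' H * x'.essentialType := by
  have hconj := finite_and_finrank_quotient_conjSeries (segreSeries x x' H)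
  have hX : (fun i => conjSegreHom x x' H (X i)) = fun i => conjSeries (segreSeries x x' H i) :=
    funext (conjSegreHom_X x x' H)
  have h := finite_and_finrank_quotient_map_algHom (conjSegreHom x x' H) rfl
    (constantCoeff_conjSegreHom_X x x' H)
    (by rw [hX]; exact hconj.1.mp hF) x'.essentialIdeal
  rw [hX, ← hconj.2, ← essentialIdeal_eq_map x x' hH hT hF] at h
  exact h

end NormalCoordinates

theorem proposition6p3 {n d : ℕ} (M M' : FormalGenericSubmanifold (n + d) d)
    (H : FormalMap (Fin (n + d)) (Fin (n + d))) (hH : H.MapsInto M M')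
    (hT : H.IsCRTransversal M')
    (x : NormalCoordinates M) (x' : NormalCoordinates M') :
    (x.IsEssentiallyFinite →
      x'.IsEssentiallyFinite ∧ NormalCoordinates.IsSegreFinite x x' H ∧
        x.essentialType = NormalCoordinates.segreMultiplicity x x' H * x'.essentialType) ∧
    (x'.IsEssentiallyFinite → NormalCoordinates.IsSegreFinite x x' H →
      x.IsEssentiallyFinite ∧
        x.essentialType = NormalCoordinates.segreMultiplicity x x' H * x'.essentialType) := by
  refine ⟨fun hM => ?_, fun hM' hF => ?_⟩
  · have hF := NormalCoordinates.isSegreFinite_of_isEssentiallyFinite x x' hH hT hM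
    have h := NormalCoordinates.essentiallyFinite_iff_and_essentialType_eq x x' hH hT hF
    exact ⟨h.1.mp hM, hF, h.2⟩
  · have h := NormalCoordinates.essentiallyFinite_iff_and_essentialType_eq x x' hH hT hF
    exact ⟨h.1.mpr hM', h.2⟩
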